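/- Let $\mathbb A=S^1\times[0,1]$ be the closed annulus. A continuum is a nonempty compact connected metric space, and it is nondegenerate if it has at least two points. A continuum is indecomposable if it is not the union of two proper subcontinua, and hereditarily indecomposable if each of its subcontinua is indecomposable. A circular chain in a metric space $X$ is a family $(D_\ell)_{\ell\in\mathbb Z/m}$, $m\ge 3$, of open (not necessarily connected) subsets of $X$ such that $D_k\cap D_\ell\neq\emptyset$ if and only if $k-\ell\in\{0,1,-1\}$ in $\mathbb Z/m$. A continuum $X$ is circle-like if for every $\varepsilon>0$ it is covered by a circular chain in $X$ all of whose members have diameter less than $\varepsilon$. It is plane separating if there is a topological embedding $e\colon X\to\mathbb R^2$ such that $\mathbb R^2\setminus e(X)$ is not connected. A pseudo-circle is a hereditarily indecomposable, circle-like, plane separating continuum. **Proposition 4.1.** Let $\varphi\colon\mathbb A\to\mathbb A$ be a continuous surjection that is monotone, i.e. $\varphi^{-1}(y)$ is connected for every $y\in\mathbb A$. Let $P\subset\mathbb A$ be a pseudo-circle, and let $Y\subset\mathbb A$ be a nondegenerate continuum such that $\varphi^{-1}(Y)=P$. Then $Y$ is a pseudo-circle. -/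

import Mathlib

open Set

/-- The closed annulus `S¹ × [0,1]`. -/
abbrev Annulus : Type := Circle × unitInterval

/-- A subset of a metric space is a continuum if it is compact, connected and nonempty
(`IsConnected` includes nonemptiness; one-point continua are allowed). -/
def IsContinuum {X : Type*} [MetricSpace X] (K : Set X) : Prop :=
  IsCompact K ∧ IsConnected K

/-- A map is monotone if all its point preimages are connected. -/
def IsMonotoneMap {X Y : Type*} [TopologicalSpace X] (f : X → Y) : Prop :=
  ∀ y : Y, IsPreconnected (f ⁻¹' {y})

/-- A continuum `K` is indecomposable if it is not the union of two proper subcontinua. -/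
def IsIndecomposable {X : Type*} [MetricSpace X] (K : Set X) : Prop :=
  ¬ ∃ A B : Set X, IsContinuum A ∧ IsContinuum B ∧ A ≠ K ∧ B ≠ K ∧ A ∪ B = K

/-- A space is hereditarily indecomposable if all its subcontinua are indecomposable. -/
def IsHereditarilyIndecomposable (X : Type*) [MetricSpace X] : Prop :=
  ∀ K : Set X, IsContinuum K → IsIndecomposable K

/-- A circular chain: at least three open sets (not necessarily connected), indexed cyclically,
two of which meet if and only if their cyclic distance is at most one. -/
structure IsCircularChain {X : Type*} [MetricSpace X] (m : ℕ) (D : ZMod m → Set X) : Prop where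
  three_le : 3 ≤ m
  isOpen_link : ∀ l, IsOpen (D l)
  inter_nonempty_iff : ∀ k l, (D k ∩ D l).Nonempty ↔ k - l = 0 ∨ k - l = 1 ∨ k - l = -1

/-- A compact metric space is circle-like if for every `ε > 0` it is covered by a circular chain
(of open subsets of the space itself) all of whose links have diameter less than `ε`. -/
def IsCircleLike (X : Type*) [MetricSpace X] : Prop :=
  ∀ ε : ℝ, 0 < ε → ∃ (m : ℕ) (D : ZMod m → Set X), IsCircularChain m D ∧
    (⋃ l, D l) = univ ∧ ∀ l, Metric.diam (D l) < ε

/-- A space is plane separating if it embeds in the plane with disconnected complement. -/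
def IsPlaneSeparating (X : Type*) [MetricSpace X] : Prop :=
  ∃ e : X → ℂ, Topology.IsEmbedding e ∧ ¬ IsPreconnected (range e)ᶜ

/-- A pseudo-circle: a hereditarily indecomposable, circle-like, plane separating continuum. -/
structure IsPseudoCircle (X : Type*) [MetricSpace X] : Prop where
  isContinuum : IsContinuum (univ : Set X)
  isCircleLike : IsCircleLike X
  isPlaneSeparating : IsPlaneSeparating X
  isHereditarilyIndecomposable : IsHereditarilyIndecomposable X

/-! Restrict `φ` to a monotone surjection `f : P → Y`. Preimages of continua under `f` are continua,
so a decomposition of a subcontinuum of `Y` pulls back to `P`, and hereditary indecomposability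
descends.

The other two properties rest on one invariant: whether every zero-free continuous function to `ℂ`
has a continuous logarithm. By Borsuk's criterion (`exists_not_hasLogOn_sub`,
`hasLogOn_of_isPreconnected_compl`) a compact plane set separates the plane exactly when some such
function on it has none. This does not depend on the embedding.

Take `k` on `P` without a logarithm. Deleting one link of a fine circular chain leaves a linear
chain, along which local logarithms glue; so `k` has a logarithm near each proper closed set, in
particular near each fibre of `f`, since `Y` is nondegenerate. Averaging these with a partition of
unity on `Y` gives `k = (h ∘ f) * exp u` (`IsMonotoneMap.exists_eq_comp_mul_exp`). Then `h` has no
logarithm, and `Y`, which embeds in the plane through the annulus, separates it.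

For circle-likeness, take a fine circular chain on `P` and call two links near if their images meet.
A maximal set of cuts, consecutive ones not near, groups the links into blocks; the points of `Y`
whose fibres lie over two successive blocks form a fine cyclic open cover
(`IsMonotoneMap.exists_cyclic_cover`). It is a genuine circular chain, because a gap between
consecutive members, or fewer than three members, would give `h` a logarithm. -/

/-! ### Continuous logarithms -/

/-- The function `f` has a continuous logarithm on the set `s`. -/
def HasLogOn {X : Type*} [TopologicalSpace X] (f : X → ℂ) (s : Set X) : Prop :=
  ∃ g : X → ℂ, ContinuousOn g s ∧ ∀ x ∈ s, Complex.exp (g x) = f x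

/-- The function `f` has, on `s`, a continuous logarithm whose imaginary part oscillates by less
than `π`. -/
def HasSmallLogOn {X : Type*} [TopologicalSpace X] (f : X → ℂ) (s : Set X) : Prop :=
  ∃ g : X → ℂ, ContinuousOn g s ∧ (∀ x ∈ s, Complex.exp (g x) = f x) ∧
    ∀ x ∈ s, ∀ y ∈ s, |(g x).im - (g y).im| < Real.pi

section HasLogOn

variable {X Y : Type*} [TopologicalSpace X] [TopologicalSpace Y] {f f' : X → ℂ} {s t : Set X}

theorem HasSmallLogOn.hasLogOn (h : HasSmallLogOn f s) : HasLogOn f s := by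
  obtain ⟨g, hg, he, -⟩ := h
  exact ⟨g, hg, he⟩

theorem HasLogOn.mono (h : HasLogOn f s) (hts : t ⊆ s) : HasLogOn f t := by
  obtain ⟨g, hg, he⟩ := h
  exact ⟨g, hg.mono hts, fun x hx => he x (hts hx)⟩

theorem HasSmallLogOn.mono (h : HasSmallLogOn f s) (hts : t ⊆ s) : HasSmallLogOn f t := by
  obtain ⟨g, hg, he, ho⟩ := h
  exact ⟨g, hg.mono hts, fun x hx => he x (hts hx), fun x hx y hy => ho x (hts hx) y (hts hy)⟩

theorem HasLogOn.congr (h : HasLogOn f s) (hff : ∀ x ∈ s, f x = f' x) : HasLogOn f' s := by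
  obtain ⟨g, hg, he⟩ := h
  exact ⟨g, hg, fun x hx => (he x hx).trans (hff x hx)⟩

theorem HasLogOn.mul (h : HasLogOn f s) (h' : HasLogOn f' s) :
    HasLogOn (fun x => f x * f' x) s := by
  obtain ⟨g, hg, he⟩ := h
  obtain ⟨g', hg', he'⟩ := h'
  exact ⟨fun x => g x + g' x, hg.add hg', fun x hx => by rw [Complex.exp_add, he x hx, he' x hx]⟩

theorem hasLogOn_of_slitPlane (hf : ContinuousOn f s) (c : ℂ)
    (h : ∀ x ∈ s, c * f x ∈ Complex.slitPlane) : HasLogOn f s := by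
  rcases eq_or_ne c 0 with rfl | hc
  · refine ⟨0, continuousOn_const, fun x hx => ?_⟩
    simpa using h x hx
  · refine ⟨fun x => Complex.log (c * f x) - Complex.log c,
      ((continuousOn_const.mul hf).clog h).sub continuousOn_const, fun x hx => ?_⟩
    rw [Complex.exp_sub, Complex.exp_log hc, Complex.exp_log (Complex.slitPlane_ne_zero (h x hx))]
    field_simp

theorem HasLogOn.comp {u : Y → X} {r : Set Y} (h : HasLogOn f s) (hu : ContinuousOn u r)
    (hrs : MapsTo u r s) : HasLogOn (fun y => f (u y)) r := by
  obtain ⟨g, hg, he⟩ := h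
  exact ⟨fun y => g (u y), hg.comp hu hrs, fun y hy => he _ (hrs hy)⟩

/-- All values lie in the open half-plane centred on the direction of one fixed value `f y`, so
their arguments relative to `f y` are less than `π / 2` in absolute value. -/
theorem hasSmallLogOn_of_ratio (hf : ContinuousOn f s) (h0 : ∀ x ∈ s, f x ≠ 0)
    (h : ∀ x ∈ s, ∀ y ∈ s, ‖f x / f y - 1‖ < 1) : HasSmallLogOn f s := by
  rcases s.eq_empty_or_nonempty with rfl | ⟨y, hy⟩
  · exact ⟨0, continuousOn_empty _, by simp, by simp⟩
  have hre : ∀ x ∈ s, 0 < (f x / f y).re := fun x hx => by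
    have h1 := (Complex.abs_re_le_norm _).trans_lt (h x hx y hy)
    rw [Complex.sub_re, Complex.one_re, abs_lt] at h1
    linarith
  have hne : ∀ x ∈ s, f x / f y ≠ 0 := fun x hx => div_ne_zero (h0 x hx) (h0 y hy)
  refine ⟨fun x => Complex.log (f x / f y) + Complex.log (f y),
    ((hf.div_const _).clog fun x hx => Or.inl (hre x hx)).add continuousOn_const, fun x hx => ?_,
    fun x hx z hz => ?_⟩
  · rw [Complex.exp_add, Complex.exp_log (hne x hx), Complex.exp_log (h0 y hy),
      div_mul_cancel₀ _ (h0 y hy)]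
  · have hx' := Complex.abs_arg_lt_pi_div_two_iff.2 (Or.inl (hre x hx))
    have hz' := Complex.abs_arg_lt_pi_div_two_iff.2 (Or.inl (hre z hz))
    simp only [Complex.add_im, Complex.log_im, add_sub_add_right_eq_sub]
    rw [abs_lt] at *
    constructor <;> linarith

theorem exists_continuousOn_union_of_isOpen {g g' : X → ℂ} (hs : IsOpen s) (ht : IsOpen t)
    (hg : ContinuousOn g s) (hg' : ContinuousOn g' t) (h : ∀ x ∈ s ∩ t, g x = g' x) :
    ∃ k : X → ℂ, ContinuousOn k (s ∪ t) ∧ EqOn k g s ∧ EqOn k g' t := by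
  classical
  have h1 : EqOn (s.piecewise g g') g s := fun x hx => by simp [hx]
  have h2 : EqOn (s.piecewise g g') g' t := fun x hx => by
    by_cases hxs : x ∈ s
    · simp [hxs, h x ⟨hxs, hx⟩]
    · simp [hxs]
  exact ⟨s.piecewise g g', (hg.congr h1).union_of_isOpen (hg'.congr h2) hs ht, h1, h2⟩

theorem exists_continuousOn_union_of_isClosed {g g' : X → ℂ} (hs : IsClosed s) (ht : IsClosed t)
    (hg : ContinuousOn g s) (hg' : ContinuousOn g' t) (h : ∀ x ∈ s ∩ t, g x = g' x) :
    ∃ k : X → ℂ, ContinuousOn k (s ∪ t) ∧ EqOn k g s ∧ EqOn k g' t := by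
  classical
  have h1 : EqOn (s.piecewise g g') g s := fun x hx => by simp [hx]
  have h2 : EqOn (s.piecewise g g') g' t := fun x hx => by
    by_cases hxs : x ∈ s
    · simp [hxs, h x ⟨hxs, hx⟩]
    · simp [hxs]
  exact ⟨s.piecewise g g', (hg.congr h1).union_of_isClosed (hg'.congr h2) hs ht, h1, h2⟩

theorem Complex.eq_of_exp_eq_of_abs_im_sub_lt {a b : ℂ} (h : Complex.exp a = Complex.exp b)
    (h' : |a.im - b.im| < 2 * Real.pi) : a = b := by
  obtain ⟨n, hn⟩ := Complex.exp_eq_exp_iff_exists_int.1 h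
  have him : a.im - b.im = n * (2 * Real.pi) := by
    rw [hn]; simp
  rw [him, abs_mul, abs_of_pos Real.two_pi_pos] at h'
  have h1 : |(n : ℝ)| < 1 := by
    by_contra! hc
    nlinarith [Real.two_pi_pos]
  have h2 : n = 0 := by
    rw [← Int.cast_abs] at h1
    exact Int.abs_lt_one_iff.1 (by exact_mod_cast h1)
  simpa [h2] using hn

/-- A function with small logarithms on the links of a linear chain of open sets has a logarithm
on their union. -/
theorem hasLogOn_of_linear_chain (n : ℕ) (U : ℕ → Set X) (hU : ∀ i < n, IsOpen (U i))
    (hadj : ∀ i < n, ∀ j < n, (U i ∩ U j).Nonempty → i ≤ j + 1)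
    (hlog : ∀ i < n, HasSmallLogOn f (U i)) : HasLogOn f (⋃ i < n, U i) := by
  rcases n with _ | n
  · exact ⟨0, by simp, by simp⟩
  -- Links and overlaps may be disconnected, so two logarithms on an overlap could differ by a
  -- varying multiple of `2πi`. The oscillation bound on the last link, carried through the
  -- induction, makes the difference constant.
  suffices H : ∀ k ≤ n, ∃ g : X → ℂ, ContinuousOn g (⋃ i < k + 1, U i) ∧
      (∀ x ∈ ⋃ i < k + 1, U i, Complex.exp (g x) = f x) ∧
      ∀ x ∈ U k, ∀ y ∈ U k, |(g x).im - (g y).im| < Real.pi by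
    obtain ⟨g, hg, he, -⟩ := H n le_rfl
    exact ⟨g, hg, he⟩
  intro k
  induction k with
  | zero =>
    intro _
    obtain ⟨g, hg, he, ho⟩ := hlog 0 (by omega)
    exact ⟨g, by simpa using hg, by simpa using he, ho⟩
  | succ k ih =>
    intro hk
    obtain ⟨g, hg, he, ho⟩ := ih (by omega)
    obtain ⟨g', hg', he', ho'⟩ := hlog (k + 1) (by omega)
    have hsub : U k ⊆ ⋃ i < k + 1, U i := fun x hx => by
      simp only [mem_iUnion]; exact ⟨k, by omega, hx⟩
    have hint : ∀ x ∈ (⋃ i < k + 1, U i) ∩ U (k + 1), x ∈ U k := by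
      rintro x ⟨hx, hx'⟩
      simp only [mem_iUnion] at hx
      obtain ⟨i, hi, hxi⟩ := hx
      have := hadj (k + 1) (by omega) i (by omega) ⟨x, hx', hxi⟩
      obtain rfl : i = k := by omega
      exact hxi
    obtain ⟨c, hc, hc'⟩ : ∃ c : ℂ, Complex.exp c = 1 ∧
        ∀ x ∈ (⋃ i < k + 1, U i) ∩ U (k + 1), g x = g' x + c := by
      rcases (U k ∩ U (k + 1)).eq_empty_or_nonempty with hemp | ⟨x₀, hx₀, hx₀'⟩
      · refine ⟨0, Complex.exp_zero, fun x hx => ?_⟩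
        have : x ∈ U k ∩ U (k + 1) := ⟨hint x hx, hx.2⟩
        simp [hemp] at this
      · have hc1 : Complex.exp (g x₀ - g' x₀) = 1 := by
          have h0 := he' x₀ hx₀'
          rw [Complex.exp_sub, he x₀ (hsub hx₀), ← h0]
          exact div_self (Complex.exp_ne_zero _)
        refine ⟨g x₀ - g' x₀, hc1, fun x hx => ?_⟩
        apply Complex.eq_of_exp_eq_of_abs_im_sub_lt
        · rw [Complex.exp_add, hc1, mul_one, he x hx.1, he' x hx.2]
        · have h1 := ho x (hint x hx) x₀ hx₀
          have h2 := ho' x hx.2 x₀ hx₀'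
          simp only [Complex.add_im, Complex.sub_im]
          rw [abs_lt] at *
          constructor <;> linarith
    have hopen : IsOpen (⋃ i < k + 1, U i) :=
      isOpen_biUnion fun i hi => hU i (by have : i < k + 1 := hi; omega)
    obtain ⟨K, hK, hK1, hK2⟩ := exists_continuousOn_union_of_isOpen hopen (hU (k + 1) (by omega)) hg
      (hg'.add continuousOn_const) hc'
    have hun : (⋃ i < k + 1 + 1, U i) = (⋃ i < k + 1, U i) ∪ U (k + 1) := by
      rw [biUnion_lt_succ]
    refine ⟨K, hun ▸ hK, fun x hx => ?_, fun x hx y hy => ?_⟩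
    · rw [hun] at hx
      rcases hx with hx | hx
      · rw [hK1 hx, he x hx]
      · rw [hK2 hx, Pi.add_apply, Complex.exp_add, hc, mul_one, he' x hx]
    · rw [hK2 hx, hK2 hy]
      simpa using ho' x hx y hy

/-- A function with small logarithms on the links of a cyclic family of open sets, two consecutive
members of which are disjoint, has a logarithm on the union of that family. -/
theorem hasLogOn_of_broken_cyclic_chain {m : ℕ} [NeZero m] (D : ZMod m → Set X)
    (hD : ∀ l, IsOpen (D l))
    (hadj : ∀ k l, (D k ∩ D l).Nonempty → k - l = 0 ∨ k - l = 1 ∨ k - l = -1)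
    (l : ZMod m) (hl : D l ∩ D (l + 1) = ∅)
    (hlog : ∀ l, HasSmallLogOn f (D l)) : HasLogOn f (⋃ l, D l) := by
  -- Count from `l + 1` round to `l`: the only adjacency that is not linear is then the broken one.
  have key := hasLogOn_of_linear_chain (f := f) m (fun i => D (l + 1 + (i : ℕ)))
    (fun i _ => hD _) ?_ (fun i _ => hlog _)
  · refine key.mono (iUnion_subset fun k x hx => ?_)
    simp only [mem_iUnion]
    refine ⟨(k - (l + 1)).val, ZMod.val_lt _, ?_⟩
    rw [ZMod.natCast_zmod_val]
    simpa using hx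
  · intro i hi j hj hne
    by_contra! hlt
    have hint : ∀ d : ℤ, |d| ≤ 1 → (i : ZMod m) - (j : ZMod m) = (d : ZMod m) →
        (i : ℤ) - j = d ∨ (i : ℤ) - j = d + m := by
      intro d hd h
      have h2 : (((i : ℤ) - j : ℤ) : ZMod m) = ((d : ℤ) : ZMod m) := by push_cast; exact h
      have h1 := (ZMod.intCast_eq_intCast_iff_dvd_sub d _ m).1 h2.symm
      obtain ⟨c, hc⟩ := h1
      rw [abs_le] at hd
      have hc0 : 0 ≤ c := by
        by_contra! hneg
        have : (m : ℤ) * c ≤ m * (-1) := by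
          apply mul_le_mul_of_nonneg_left <;> omega
        omega
      have hc1 : c < 2 := by
        by_contra! hneg
        have : (m : ℤ) * 2 ≤ m * c := by
          apply mul_le_mul_of_nonneg_left <;> omega
        omega
      interval_cases c <;> omega
    have hsub : l + 1 + (i : ZMod m) - (l + 1 + (j : ZMod m)) = i - j := by ring
    have h3 := hadj _ _ hne
    rw [hsub] at h3
    rcases h3 with h | h | h
    · rcases hint 0 (by simp) (by simpa using h) with h | h <;> omega
    · rcases hint 1 (by simp) (by simpa using h) with h | h <;> omega
    · rcases hint (-1) (by simp) (by simpa using h) with h | h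
      · omega
      · obtain rfl : j = 0 := by omega
        have hi' : i + 1 = m := by omega
        have hil : l + 1 + (i : ZMod m) = l := by
          have : ((i + 1 : ℕ) : ZMod m) = 0 := by rw [hi']; simp
          push_cast at this
          linear_combination this
        simp only [hil, Nat.cast_zero, add_zero] at hne
        rw [hl] at hne
        exact Set.not_nonempty_empty hne

end HasLogOn

theorem exists_forall_dist_lt_ratio {X : Type*} [MetricSpace X] {K : Set X} (hK : IsCompact K)
    {f : X → ℂ} (hf : ContinuousOn f K) (h0 : ∀ x ∈ K, f x ≠ 0) :
    ∃ δ > 0, ∀ x ∈ K, ∀ y ∈ K, dist x y < δ → ‖f x / f y - 1‖ < 1 := by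
  obtain ⟨c, hc, hcf⟩ : ∃ c > 0, ∀ x ∈ K, c ≤ ‖f x‖ := by
    rcases K.eq_empty_or_nonempty with rfl | hne
    · exact ⟨1, one_pos, by simp⟩
    · obtain ⟨x, hx, hmin⟩ := hK.exists_isMinOn hne hf.norm
      exact ⟨‖f x‖, norm_pos_iff.2 (h0 x hx), fun y hy => hmin hy⟩
  obtain ⟨δ, hδ, h⟩ := Metric.uniformContinuousOn_iff.1 (hK.uniformContinuousOn_of_continuous hf)
    c hc
  refine ⟨δ, hδ, fun x hx y hy hxy => ?_⟩
  have h1 := h x hx y hy hxy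
  rw [dist_eq_norm] at h1
  rw [div_sub_one (h0 y hy), norm_div, div_lt_one (norm_pos_iff.2 (h0 y hy))]
  exact h1.trans_le (hcf y hy)

/-! ### Logarithms on compact subsets of the plane -/

/-- A subgroup of integer-valued functions that contains the constants and the step functions
with jumps off a compact set `E` of reals contains every integer-valued function continuous
on `E`, up to its values off `E`. -/
theorem exists_mem_eqOn_of_steps {E : Set ℝ} (hE : IsCompact E) (G : AddSubgroup (ℝ → ℤ))
    (hstep : ∀ s ∉ E, ∃ m ∈ G, ∀ t ∈ E, m t = if s < t then 1 else 0)
    (n : ℝ → ℤ) (hn : ContinuousOn n E) : ∃ m ∈ G, EqOn m n E := by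
  -- `T` consists of the `t` up to which `n` can be matched by a member of `G` that is constant on
  -- `E` from `t` on. It is clopen and contains points to the left of `E`.
  let T : Set ℝ := {t | ∃ m ∈ G, (∀ x ∈ E, x ≤ t → m x = n x) ∧
    ∃ c, ∀ x ∈ E, t ≤ x → m x = c}
  obtain ⟨a, ha⟩ := hE.bddBelow
  obtain ⟨b, hb⟩ := hE.bddAbove
  suffices hT : T = univ by
    obtain ⟨m, hm, h1, -⟩ : b ∈ T := hT ▸ mem_univ b
    exact ⟨m, hm, fun x hx => h1 x hx (hb hx)⟩
  have hloc : ∀ t₀ : ℝ, ∃ ε > 0, ∀ s ∈ Ioo (t₀ - ε) (t₀ + ε), ∀ t ∈ Ioo (t₀ - ε) (t₀ + ε),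
      s ∈ T → t ∈ T := by
    intro t₀
    obtain ⟨v, ε, hε, hv⟩ : ∃ v : ℤ, ∃ ε > 0, ∀ x ∈ Ioo (t₀ - ε) (t₀ + ε), x ∈ E → n x = v := by
      by_cases ht : t₀ ∈ E
      · obtain ⟨ε, hε, h⟩ := Metric.continuousOn_iff.1 hn t₀ ht 1 one_pos
        refine ⟨n t₀, ε, hε, fun x hx hxE => ?_⟩
        have h1 := h x hxE (by rw [Real.dist_eq, abs_lt]; constructor <;> linarith [hx.1, hx.2])
        rw [Int.dist_eq'] at h1
        have h2 : |n x - n t₀| < 1 := by exact_mod_cast h1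
        have := Int.abs_lt_one_iff.1 h2
        omega
      · obtain ⟨ε, hε, h⟩ := Metric.isOpen_iff.1 hE.isClosed.isOpen_compl t₀ ht
        refine ⟨0, ε, hε, fun x hx hxE => ?_⟩
        refine absurd hxE (h ?_)
        rw [Metric.mem_ball, Real.dist_eq, abs_lt]
        constructor <;> linarith [hx.1, hx.2]
    refine ⟨ε, hε, ?_⟩
    rintro s hs t ht ⟨m, hm, h1, c, hc⟩
    have hbt : ∀ x ∈ E, min s t ≤ x → x ≤ max s t → n x = v := fun x hx hx1 hx2 => by
      refine hv x ⟨?_, ?_⟩ hx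
      · exact (lt_min hs.1 ht.1).trans_le hx1
      · exact hx2.trans_lt (max_lt hs.2 ht.2)
    by_cases hsE : s ∈ E
    · have hcv : c = v := by
        rw [← hc s hsE le_rfl, h1 s hsE le_rfl, hbt s hsE (min_le_left _ _) (le_max_left _ _)]
      refine ⟨m, hm, fun x hx hxt => ?_, v, fun x hx hxt => ?_⟩
      · rcases le_total x s with hxs | hxs
        · exact h1 x hx hxs
        · rw [hc x hx hxs, hcv, hbt x hx ((min_le_left _ _).trans hxs) (hxt.trans (le_max_right _ _))]
      · rcases le_total x s with hxs | hxs
        · rw [h1 x hx hxs, hbt x hx ((min_le_right _ _).trans hxt) (hxs.trans (le_max_left _ _))]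
        · rw [hc x hx hxs, hcv]
    -- Off `E` the constant `c` may differ from the local value `v` of `n`; a step at `s` of height
    -- `v - c` corrects it.
    · obtain ⟨m', hm', hst⟩ := hstep s hsE
      have hL : ∀ x ∈ E, x ≤ s → (m + (v - c) • m') x = n x := fun x hx hxs => by
        simp [hst x hx, not_lt.2 hxs, h1 x hx hxs]
      have hR : ∀ x ∈ E, s ≤ x → (m + (v - c) • m') x = v := fun x hx hxs => by
        have hlt : s < x := lt_of_le_of_ne hxs (by rintro rfl; exact hsE hx)
        simp [hst x hx, hlt, hc x hx hxs]
      refine ⟨m + (v - c) • m', G.add_mem hm (G.zsmul_mem hm' _), fun x hx hxt => ?_, v,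
        fun x hx hxt => ?_⟩
      · rcases le_total x s with hxs | hxs
        · exact hL x hx hxs
        · rw [hR x hx hxs, hbt x hx ((min_le_left _ _).trans hxs) (hxt.trans (le_max_right _ _))]
      · rcases le_total x s with hxs | hxs
        · rw [hL x hx hxs, hbt x hx ((min_le_right _ _).trans hxt) (hxs.trans (le_max_left _ _))]
        · exact hR x hx hxs
  have hopen : IsOpen T := by
    refine Metric.isOpen_iff.2 fun t ht => ?_
    obtain ⟨ε, hε, h⟩ := hloc t
    refine ⟨ε, hε, fun x hx => ?_⟩
    rw [Real.ball_eq_Ioo] at hx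
    exact h t ⟨by linarith, by linarith⟩ x hx ht
  have hopen' : IsOpen Tᶜ := by
    refine Metric.isOpen_iff.2 fun t ht => ?_
    obtain ⟨ε, hε, h⟩ := hloc t
    refine ⟨ε, hε, fun x hx hxT => ht ?_⟩
    rw [Real.ball_eq_Ioo] at hx
    exact h x hx t ⟨by linarith, by linarith⟩ hxT
  refine IsClopen.eq_univ ⟨⟨hopen'⟩, hopen⟩ ⟨a - 1, 0, G.zero_mem, fun x hx hxa => ?_, 0,
    fun _ _ _ => rfl⟩
  linarith [ha hx]

/-- Logarithms on the two parts into which a line cuts a compact set can be glued, if all linear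
functions `z - p` without a zero in the set have logarithms. -/
theorem HasLogOn.of_cut {A : Set ℂ} (hA : IsCompact A)
    (hp : ∀ p ∉ A, HasLogOn (fun z => z - p) A) {f : ℂ → ℂ} {ω : ℂ} (hω : ω ≠ 0) (c : ℝ)
    (h₁ : HasLogOn f (A ∩ {z | (ω * z).re ≤ c})) (h₂ : HasLogOn f (A ∩ {z | c ≤ (ω * z).re})) :
    HasLogOn f A := by
  obtain ⟨g₁, hg₁, he₁⟩ := h₁
  obtain ⟨g₂, hg₂, he₂⟩ := h₂
  have hcont : Continuous fun z : ℂ => (ω * z).re := by fun_prop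
  set A₁ := A ∩ {z | (ω * z).re ≤ c} with hA₁
  set A₂ := A ∩ {z | c ≤ (ω * z).re} with hA₂
  have hcl₁ : IsClosed A₁ := hA.isClosed.inter (isClosed_le hcont continuous_const)
  have hcl₂ : IsClosed A₂ := hA.isClosed.inter (isClosed_le continuous_const hcont)
  have hun : A₁ ∪ A₂ = A := by
    rw [hA₁, hA₂, ← inter_union_distrib_left]
    exact inter_eq_left.2 fun z _ => le_total (ω * z).re c
  let q : ℝ → ℂ := fun t => (c + t * Complex.I) / ω
  have hq : Continuous q := by fun_prop
  have hωq : ∀ t, ω * q t = c + t * Complex.I := fun t => mul_div_cancel₀ _ hω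
  have hqre : ∀ t, (ω * q t).re = c := fun t => by rw [hωq]; simp
  have hqz : ∀ z, (ω * z).re = c → q (ω * z).im = z := fun z hz => by
    apply mul_left_cancel₀ hω
    rw [hωq, ← hz, Complex.re_add_im]
  set E : Set ℝ := q ⁻¹' A with hEdef
  have hE : IsCompact E := by
    have : E = (fun z : ℂ => (ω * z).im) '' (A₁ ∩ A₂) := by
      ext t
      constructor
      · intro ht
        refine ⟨q t, ⟨⟨ht, (hqre t).le⟩, ⟨ht, (hqre t).ge⟩⟩, ?_⟩
        simp [hωq]
      · rintro ⟨z, ⟨hz₁, hz₂⟩, rfl⟩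
        change q _ ∈ A
        rw [hqz z (le_antisymm hz₁.2 hz₂.2)]
        exact hz₁.1
    rw [this]
    exact (((hA.of_isClosed_subset hcl₁ inter_subset_left).inter_right hcl₂).image (by fun_prop))
  have hqA₁ : ∀ t ∈ E, q t ∈ A₁ := fun t ht => ⟨ht, (hqre t).le⟩
  have hqA₂ : ∀ t ∈ E, q t ∈ A₂ := fun t ht => ⟨ht, (hqre t).ge⟩
  have hpi : (2 * Real.pi * Complex.I : ℂ) ≠ 0 := Complex.two_pi_I_ne_zero
  -- On the cutting line `g₁ - g₂` is `2πi` times an integer function. `G` collects the integer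
  -- functions that can be removed by changing each logarithm, on its own side, by multiples of
  -- `2πi`.
  let G : AddSubgroup (ℝ → ℤ) :=
    { carrier := {n | ∃ u₁ u₂ : ℂ → ℂ, ContinuousOn u₁ A₁ ∧ ContinuousOn u₂ A₂ ∧
        (∀ z ∈ A₁, Complex.exp (u₁ z) = 1) ∧ (∀ z ∈ A₂, Complex.exp (u₂ z) = 1) ∧
        ∀ t ∈ E, u₁ (q t) - u₂ (q t) = n t * (2 * Real.pi * Complex.I)}
      add_mem' := by
        rintro n n' ⟨u₁, u₂, h1, h2, h3, h4, h5⟩ ⟨u₁', u₂', h1', h2', h3', h4', h5'⟩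
        refine ⟨u₁ + u₁', u₂ + u₂', h1.add h1', h2.add h2', fun z hz => ?_, fun z hz => ?_,
          fun t ht => ?_⟩
        · rw [Pi.add_apply, Complex.exp_add, h3 z hz, h3' z hz, one_mul]
        · rw [Pi.add_apply, Complex.exp_add, h4 z hz, h4' z hz, one_mul]
        · simp only [Pi.add_apply, Int.cast_add]
          linear_combination h5 t ht + h5' t ht
      zero_mem' := ⟨0, 0, continuousOn_const, continuousOn_const, by simp, by simp, by simp⟩
      neg_mem' := by
        rintro n ⟨u₁, u₂, h1, h2, h3, h4, h5⟩
        refine ⟨-u₁, -u₂, h1.neg, h2.neg, fun z hz => ?_, fun z hz => ?_, fun t ht => ?_⟩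
        · rw [Pi.neg_apply, Complex.exp_neg, h3 z hz, inv_one]
        · rw [Pi.neg_apply, Complex.exp_neg, h4 z hz, inv_one]
        · simp only [Pi.neg_apply, Int.cast_neg]
          linear_combination -h5 t ht }
  have hstep : ∀ s ∉ E, ∃ m ∈ G, ∀ t ∈ E, m t = if s < t then 1 else 0 := by
    intro s hs
    obtain ⟨w, hw, hew⟩ := hp (q s) hs
    have hne : ∀ z ∈ A, ω * (z - q s) ≠ 0 := fun z hz =>
      mul_ne_zero hω (sub_ne_zero.2 (by rintro rfl; exact hs hz))
    have hre : ∀ z, (ω * (z - q s)).re = (ω * z).re - c := fun z => by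
      rw [mul_sub, Complex.sub_re, hqre]
    have hs₁ : ∀ z ∈ A₁, -(ω * (z - q s)) ∈ Complex.slitPlane := fun z hz => by
      have h1 : (ω * z).re ≤ c := hz.2
      rcases h1.lt_or_eq with h | h
      · left; rw [Complex.neg_re, hre]; linarith
      · right
        intro him
        refine hne z hz.1 (Complex.ext ?_ ?_)
        · rw [hre, h]; simp
        · rw [Complex.neg_im, neg_eq_zero] at him
          exact him
    have hs₂ : ∀ z ∈ A₂, ω * (z - q s) ∈ Complex.slitPlane := fun z hz => by
      have h1 : c ≤ (ω * z).re := hz.2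
      rcases h1.lt_or_eq with h | h
      · left; rw [hre]; linarith
      · right
        intro him
        refine hne z hz.1 (Complex.ext ?_ ?_)
        · rw [hre, h]; simp
        · simpa using him
    -- Compare the logarithm `w` of `z - q s` with a principal branch on each side of the line. The
    -- two branches disagree by a full turn on just one of the two rays from `q s`; the summand `πi`
    -- makes the difference `0` for `t < s` and `2πi` for `t > s`.
    refine ⟨fun t => if s < t then 1 else 0,
      ⟨fun z => w z + Complex.log ω - Complex.log (-(ω * (z - q s))) + Real.pi * Complex.I,
      fun z => w z + Complex.log ω - Complex.log (ω * (z - q s)), ?_, ?_, ?_, ?_, ?_⟩,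
      fun t _ => rfl⟩
    · exact (((hw.mono inter_subset_left).add continuousOn_const).sub
        (ContinuousOn.clog (by fun_prop) hs₁)).add continuousOn_const
    · exact ((hw.mono inter_subset_left).add continuousOn_const).sub
        (ContinuousOn.clog (by fun_prop) hs₂)
    · intro z hz
      have := hne z hz.1
      rw [Complex.exp_add, Complex.exp_sub, Complex.exp_add, hew z hz.1, Complex.exp_log hω,
        Complex.exp_log (neg_ne_zero.2 this), Complex.exp_pi_mul_I, mul_comm (z - q s), div_neg,
        div_self this]
      norm_num
    · intro z hz
      have := hne z hz.1
      rw [Complex.exp_sub, Complex.exp_add, hew z hz.1, Complex.exp_log hω,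
        Complex.exp_log this, mul_comm (z - q s), div_self this]
    · intro t ht
      have hts : t ≠ s := by rintro rfl; exact hs ht
      have hval : ω * (q t - q s) = ((t - s : ℝ) : ℂ) * Complex.I := by
        rw [mul_sub, hωq, hωq]; push_cast; ring
      simp only [hval]
      rcases lt_or_gt_of_ne hts with h | h
      · rw [if_neg (not_lt.2 h.le)]
        have e1 : -(((t - s : ℝ) : ℂ) * Complex.I) = ((s - t : ℝ) : ℂ) * Complex.I := by
          push_cast; ring
        have e2 : ((t - s : ℝ) : ℂ) * Complex.I = ((s - t : ℝ) : ℂ) * (-Complex.I) := by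
          push_cast; ring
        rw [e1, e2, Complex.log_ofReal_mul (by linarith) Complex.I_ne_zero,
          Complex.log_ofReal_mul (by linarith) (neg_ne_zero.2 Complex.I_ne_zero),
          Complex.log_I, Complex.log_neg_I]
        push_cast; ring
      · rw [if_pos h]
        have e1 : -(((t - s : ℝ) : ℂ) * Complex.I) = ((t - s : ℝ) : ℂ) * (-Complex.I) := by
          push_cast; ring
        rw [e1, Complex.log_ofReal_mul (by linarith) Complex.I_ne_zero,
          Complex.log_ofReal_mul (by linarith) (neg_ne_zero.2 Complex.I_ne_zero),
          Complex.log_I, Complex.log_neg_I]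
        push_cast; ring
  have hex : ∀ t, ∃ k : ℤ, t ∈ E → g₁ (q t) - g₂ (q t) = k * (2 * Real.pi * Complex.I) := by
    intro t
    by_cases ht : t ∈ E
    · obtain ⟨k, hk⟩ := Complex.exp_eq_exp_iff_exists_int.1
        ((he₁ _ (hqA₁ t ht)).trans (he₂ _ (hqA₂ t ht)).symm)
      exact ⟨k, fun _ => by rw [hk]; ring⟩
    · exact ⟨0, fun h => absurd h ht⟩
  choose n hn using hex
  have hnc : ContinuousOn n E := by
    have hd : ContinuousOn (fun t => ((g₁ (q t) - g₂ (q t)) / (2 * Real.pi * Complex.I)).re) E :=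
      Complex.continuous_re.comp_continuousOn
        (((hg₁.comp hq.continuousOn hqA₁).sub (hg₂.comp hq.continuousOn hqA₂)).div_const _)
    have hd' : ContinuousOn (fun t => (n t : ℝ)) E := hd.congr fun t ht => by
      simp only [hn t ht, mul_div_cancel_right₀ _ hpi, Complex.intCast_re]
    exact Int.isClosedEmbedding_coe_real.isInducing.continuousOn_iff.2 hd'
  obtain ⟨m, ⟨u₁, u₂, hu₁, hu₂, hv₁, hv₂, hm⟩, hmn⟩ := exists_mem_eqOn_of_steps hE G hstep n hnc
  obtain ⟨k, hk, hk₁, hk₂⟩ := exists_continuousOn_union_of_isClosed hcl₁ hcl₂ (hg₁.sub hu₁)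
    (hg₂.sub hu₂) fun z hz => by
      have hzq := hqz z (le_antisymm hz.1.2 hz.2.2)
      have hzE : (ω * z).im ∈ E := by
        change q _ ∈ A
        rw [hzq]; exact hz.1.1
      have h1 := hm _ hzE
      have h2 := hn _ hzE
      rw [hmn hzE] at h1
      rw [hzq] at h1 h2
      simp only [Pi.sub_apply]
      linear_combination h2 - h1
  refine ⟨k, hun ▸ hk, fun z hz => ?_⟩
  rw [← hun] at hz
  rcases hz with hz | hz
  · rw [hk₁ hz, Pi.sub_apply, Complex.exp_sub, hv₁ z hz, div_one, he₁ z hz]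
  · rw [hk₂ hz, Pi.sub_apply, Complex.exp_sub, hv₂ z hz, div_one, he₂ z hz]

/-- If all linear functions without a zero in the compact set `K` have logarithms on `K`, so do
all continuous functions without a zero in `K`. -/
theorem hasLogOn_of_forall_hasLogOn_sub {K : Set ℂ} (hK : IsCompact K)
    (hp : ∀ p ∉ K, HasLogOn (fun z => z - p) K) {f : ℂ → ℂ} (hf : ContinuousOn f K)
    (h0 : ∀ z ∈ K, f z ≠ 0) : HasLogOn f K := by
  let B : ℝ → ℝ → ℝ → ℝ → Set ℂ := fun a b c d => K ∩ (Icc a b ×ℂ Icc c d)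
  have hB : ∀ a b c d, IsCompact (B a b c d) := fun a b c d =>
    hK.inter_right (isClosed_Icc.reProdIm isClosed_Icc)
  -- The hypothesis passes to boxes: a new point `p` lies in `K` but outside the box, which then
  -- sits in a half-plane bounded by a line through `p`.
  have hBp : ∀ a b c d, ∀ p ∉ B a b c d, HasLogOn (fun z => z - p) (B a b c d) := by
    intro a b c d p hpB
    by_cases hpK : p ∈ K
    · have hsub : ContinuousOn (fun z => z - p) (B a b c d) := by fun_prop
      have hbox : p ∉ Icc a b ×ℂ Icc c d := fun h => hpB ⟨hpK, h⟩
      simp only [Complex.mem_reProdIm, mem_Icc, not_and_or, not_le] at hbox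
      rcases hbox with (h | h) | (h | h)
      · refine hasLogOn_of_slitPlane hsub 1 fun z hz => Or.inl ?_
        have := hz.2.1.1
        simp only [Complex.mul_re, Complex.sub_re, Complex.one_re, Complex.one_im]
        linarith
      · refine hasLogOn_of_slitPlane hsub (-1) fun z hz => Or.inl ?_
        have := hz.2.1.2
        simp only [Complex.mul_re, Complex.sub_re, Complex.neg_re, Complex.neg_im,
          Complex.one_re, Complex.one_im]
        linarith
      · refine hasLogOn_of_slitPlane hsub (-Complex.I) fun z hz => Or.inl ?_
        have := hz.2.2.1
        simp only [Complex.mul_re, Complex.sub_im, Complex.neg_re, Complex.neg_im,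
          Complex.I_re, Complex.I_im]
        linarith
      · refine hasLogOn_of_slitPlane hsub Complex.I fun z hz => Or.inl ?_
        have := hz.2.2.2
        simp only [Complex.mul_re, Complex.sub_im, Complex.I_re, Complex.I_im]
        linarith
    · exact (hp p hpK).mono inter_subset_left
  have hre : ∀ a b b' c d, a ≤ b → b ≤ b' → HasLogOn f (B a b c d) → HasLogOn f (B b b' c d) →
      HasLogOn f (B a b' c d) := by
    intro a b b' c d hab hbb h1 h2
    refine HasLogOn.of_cut (hB _ _ _ _) (hBp _ _ _ _) one_ne_zero b (h1.mono ?_) (h2.mono ?_)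
    · rintro z ⟨⟨hzK, hz1, hz2⟩, hz⟩
      simp only [one_mul, mem_ofPred_eq] at hz
      exact ⟨hzK, ⟨hz1.1, hz⟩, hz2⟩
    · rintro z ⟨⟨hzK, hz1, hz2⟩, hz⟩
      simp only [one_mul, mem_ofPred_eq] at hz
      exact ⟨hzK, ⟨hz, hz1.2⟩, hz2⟩
  have him : ∀ a b c d d', c ≤ d → d ≤ d' → HasLogOn f (B a b c d) → HasLogOn f (B a b d d') →
      HasLogOn f (B a b c d') := by
    intro a b c d d' hcd hdd h1 h2
    refine HasLogOn.of_cut (hB _ _ _ _) (hBp _ _ _ _) (neg_ne_zero.2 Complex.I_ne_zero) d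
      (h1.mono ?_) (h2.mono ?_)
    · rintro z ⟨⟨hzK, hz1, hz2⟩, hz⟩
      simp only [mem_ofPred_eq, Complex.mul_re, Complex.neg_re, Complex.I_re, Complex.neg_im,
        Complex.I_im] at hz
      exact ⟨hzK, hz1, ⟨hz2.1, by linarith⟩⟩
    · rintro z ⟨⟨hzK, hz1, hz2⟩, hz⟩
      simp only [mem_ofPred_eq, Complex.mul_re, Complex.neg_re, Complex.I_re, Complex.neg_im,
        Complex.I_im] at hz
      exact ⟨hzK, hz1, ⟨by linarith, hz2.2⟩⟩
  obtain ⟨δ, hδ, hsmall⟩ := exists_forall_dist_lt_ratio hK hf h0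
  obtain ⟨R, hR⟩ := hK.isBounded.exists_norm_le
  -- Points of a cell of side `η` are at distance at most `2 * η < δ`.
  set η := δ / 3 with hη
  have hη0 : 0 < η := by positivity
  have hcell : ∀ a c, HasLogOn f (B a (a + η) c (c + η)) := by
    intro a c
    refine (hasSmallLogOn_of_ratio (hf.mono inter_subset_left) (fun z hz => h0 z hz.1)
      fun x hx y hy => hsmall x hx.1 y hy.1 ?_).hasLogOn
    rw [Complex.dist_eq]
    refine (Complex.norm_le_abs_re_add_abs_im _).trans_lt ?_
    have h1 : |(x - y).re| ≤ η := by
      rw [Complex.sub_re, abs_le]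
      constructor <;> linarith [hx.2.1.1, hx.2.1.2, hy.2.1.1, hy.2.1.2]
    have h2 : |(x - y).im| ≤ η := by
      rw [Complex.sub_im, abs_le]
      constructor <;> linarith [hx.2.2.1, hx.2.2.2, hy.2.2.1, hy.2.2.2]
    linarith
  have hrow : ∀ a c (n : ℕ), HasLogOn f (B a (a + (n + 1) * η) c (c + η)) := by
    intro a c n
    induction n with
    | zero => simpa using hcell a c
    | succ n ih =>
      refine hre _ _ _ _ _ ?_ ?_ ih ?_
      · nlinarith [(n.cast_nonneg : (0 : ℝ) ≤ n)]
      · push_cast; nlinarith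
      · convert hcell (a + (n + 1) * η) c using 2
        push_cast; ring
  have hgrid : ∀ a c (n k : ℕ), HasLogOn f (B a (a + (n + 1) * η) c (c + (k + 1) * η)) := by
    intro a c n k
    induction k with
    | zero => simpa using hrow a c n
    | succ k ih =>
      refine him _ _ _ _ _ ?_ ?_ ih ?_
      · nlinarith [(k.cast_nonneg : (0 : ℝ) ≤ k)]
      · push_cast; nlinarith
      · convert hrow a (c + (k + 1) * η) n using 2
        push_cast; ring
  obtain ⟨n, hn⟩ := exists_nat_gt (2 * R / η)
  rw [div_lt_iff₀ hη0] at hn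
  refine (hgrid (-R) (-R) n n).mono fun z hz => ⟨hz, ?_⟩
  have h1 := abs_le.1 ((Complex.abs_re_le_norm z).trans (hR z hz))
  have h2 := abs_le.1 ((Complex.abs_im_le_norm z).trans (hR z hz))
  exact ⟨⟨h1.1, by linarith⟩, ⟨h2.1, by linarith⟩⟩

/-! ### Borsuk's criterion: logarithms and separation of the plane -/

theorem hasLogOn_sub_of_norm_lt {K : Set ℂ} {p : ℂ} (hp : ∀ z ∈ K, ‖z‖ < ‖p‖) :
    HasLogOn (fun z => z - p) K := by
  refine hasLogOn_of_slitPlane (by fun_prop) (-p⁻¹) fun z hz => Or.inl ?_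
  have hp0 : p ≠ 0 := norm_pos_iff.1 ((norm_nonneg z).trans_lt (hp z hz))
  have h1 : -p⁻¹ * (z - p) = 1 - z / p := by field_simp; ring
  have h2 : ‖z / p‖ < 1 := by
    rw [norm_div, div_lt_one (norm_pos_iff.2 hp0)]
    exact hp z hz
  rw [h1, Complex.sub_re, Complex.one_re]
  linarith [(Complex.re_le_norm (z / p))]

/-- If the complement of a compact plane set is connected, then every continuous function without
zeros on it has a logarithm. -/
theorem hasLogOn_of_isPreconnected_compl {K : Set ℂ} (hK : IsCompact K)
    (hc : IsPreconnected Kᶜ) {f : ℂ → ℂ} (hf : ContinuousOn f K) (h0 : ∀ z ∈ K, f z ≠ 0) :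
    HasLogOn f K := by
  refine hasLogOn_of_forall_hasLogOn_sub hK ?_ hf h0
  -- For `q` near `p` the ratio `(z - q) / (z - p)` stays in the right half-plane. Having a
  -- logarithm is thus locally constant in `p`, and it holds for `p` far away.
  have hloc : ∀ p ∉ K, ∃ ε > 0, ∀ q, dist q p < ε →
      (HasLogOn (fun z => z - p) K ↔ HasLogOn (fun z => z - q) K) := by
    intro p hp
    obtain ⟨ε, hε, hball⟩ := Metric.isOpen_iff.1 hK.isClosed.isOpen_compl p hp
    have hfar : ∀ z ∈ K, ε ≤ ‖z - p‖ := fun z hz => by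
      by_contra! hlt
      exact hball (by rwa [Metric.mem_ball, dist_eq_norm]) hz
    refine ⟨ε, hε, fun q hq => ?_⟩
    have hqK : q ∉ K := hball hq
    rw [dist_eq_norm] at hq
    have hne : ∀ z ∈ K, z - p ≠ 0 := fun z hz => sub_ne_zero.2 (by rintro rfl; exact hp hz)
    have hne' : ∀ z ∈ K, z - q ≠ 0 := fun z hz => sub_ne_zero.2 (by rintro rfl; exact hqK hz)
    have hmem : ∀ z ∈ K, (z - q) / (z - p) ∈ Complex.slitPlane := fun z hz => by
      left
      have h1 : (z - q) / (z - p) = 1 - (q - p) / (z - p) := by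
        have := hne z hz
        field_simp; ring
      have h2 : ‖(q - p) / (z - p)‖ < 1 := by
        rw [norm_div, div_lt_one (norm_pos_iff.2 (hne z hz))]
        exact hq.trans_le (hfar z hz)
      rw [h1, Complex.sub_re, Complex.one_re]
      linarith [(Complex.re_le_norm ((q - p) / (z - p)))]
    have hcont : ContinuousOn (fun z => (z - q) / (z - p)) K :=
      ContinuousOn.div (by fun_prop) (by fun_prop) hne
    obtain ⟨r, hr, her⟩ : HasLogOn (fun z => (z - q) / (z - p)) K :=
      hasLogOn_of_slitPlane hcont 1 fun z hz => by rw [one_mul]; exact hmem z hz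
    constructor
    · rintro ⟨g, hg, he⟩
      refine ⟨g + r, hg.add hr, fun z hz => ?_⟩
      rw [Pi.add_apply, Complex.exp_add, he z hz, her z hz, mul_div_cancel₀ _ (hne z hz)]
    · rintro ⟨g, hg, he⟩
      refine ⟨g - r, hg.sub hr, fun z hz => ?_⟩
      rw [Pi.sub_apply, Complex.exp_sub, he z hz, her z hz, div_div_cancel₀ (hne' z hz)]
  let V : Set ℂ := {p | p ∉ K ∧ HasLogOn (fun z => z - p) K}
  let W : Set ℂ := {p | p ∉ K ∧ ¬ HasLogOn (fun z => z - p) K}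
  have hV : IsOpen V := by
    refine Metric.isOpen_iff.2 fun p hp => ?_
    obtain ⟨ε, hε, h⟩ := hloc p hp.1
    obtain ⟨ε', hε', hball⟩ := Metric.isOpen_iff.1 hK.isClosed.isOpen_compl p hp.1
    exact ⟨min ε ε', lt_min hε hε', fun q hq => ⟨hball (Metric.ball_subset_ball (min_le_right _ _) hq),
      (h q (Metric.ball_subset_ball (min_le_left _ _) hq)).1 hp.2⟩⟩
  have hW : IsOpen W := by
    refine Metric.isOpen_iff.2 fun p hp => ?_
    obtain ⟨ε, hε, h⟩ := hloc p hp.1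
    obtain ⟨ε', hε', hball⟩ := Metric.isOpen_iff.1 hK.isClosed.isOpen_compl p hp.1
    exact ⟨min ε ε', lt_min hε hε', fun q hq => ⟨hball (Metric.ball_subset_ball (min_le_right _ _) hq),
      fun hq' => hp.2 ((h q (Metric.ball_subset_ball (min_le_left _ _) hq)).2 hq')⟩⟩
  by_contra! hcon
  obtain ⟨p, hpK, hp⟩ := hcon
  obtain ⟨R, hR⟩ := hK.isBounded.exists_norm_le
  have hfar : ∀ z ∈ K, ‖z‖ < ‖((|R| + 1 : ℝ) : ℂ)‖ := fun z hz => by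
    rw [Complex.norm_real, Real.norm_of_nonneg (by positivity)]
    linarith [hR z hz, le_abs_self R]
  obtain ⟨q, -, hqV, hqW⟩ := hc V W hV hW
    (fun q hq => by
      by_cases h : HasLogOn (fun z => z - q) K
      · exact Or.inl ⟨hq, h⟩
      · exact Or.inr ⟨hq, h⟩)
    ⟨_, fun h => (hfar _ h).false, fun h => (hfar _ h).false, hasLogOn_sub_of_norm_lt hfar⟩
    ⟨p, hpK, hpK, hp⟩
  exact hqW.2 hqV.2

theorem hasLogOn_closedBall (R : ℝ) {f : ℂ → ℂ} (hf : Continuous f) (h0 : ∀ z, f z ≠ 0) :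
    HasLogOn f (Metric.closedBall 0 R) := by
  refine hasLogOn_of_forall_hasLogOn_sub (isCompact_closedBall _ _) (fun p hp => ?_)
    hf.continuousOn fun z _ => h0 z
  refine hasLogOn_sub_of_norm_lt fun z hz => ?_
  rw [mem_closedBall_zero_iff] at hz
  rw [mem_closedBall_zero_iff, not_le] at hp
  exact hz.trans_lt hp

theorem isPreconnected_norm_gt (R : ℝ) : IsPreconnected {z : ℂ | R < ‖z‖} := by
  rcases lt_or_ge R 0 with hR | hR
  · have : {z : ℂ | R < ‖z‖} = univ := eq_univ_of_forall fun z => hR.trans_le (norm_nonneg z)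
    rw [this]
    exact isPreconnected_univ
  have : {z : ℂ | R < ‖z‖} =
      (fun x : ℝ × ℝ => (x.1 : ℂ) * Complex.exp (x.2 * Complex.I)) '' (Ioi R ×ˢ univ) := by
    ext z
    constructor
    · intro hz
      exact ⟨(‖z‖, Complex.arg z), ⟨hz, mem_univ _⟩, Complex.norm_mul_exp_arg_mul_I z⟩
    · rintro ⟨⟨r, t⟩, ⟨hr, -⟩, rfl⟩
      have hr' : R < r := hr
      simp only [mem_ofPred_eq, norm_mul, Complex.norm_real, Complex.norm_exp_ofReal_mul_I, mul_one]
      exact hr'.trans_le (le_abs_self r)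
  rw [this]
  exact (isPreconnected_Ioi.prod isPreconnected_univ).image _ (by fun_prop)

/-- Since `|p| < R`, the factor `z / (z - p)` has a logarithm on the circle, so `p = 0` may be
assumed. A logarithm of `z` along `R * exp (i t)` differs from `i t` by a constant, which is
impossible after a full turn. -/
theorem not_hasLogOn_sub_sphere {R : ℝ} {p : ℂ} (hR : ‖p‖ < R) :
    ¬ HasLogOn (fun z => z - p) (Metric.sphere 0 R) := by
  intro h
  have hR0 : 0 < R := (norm_nonneg p).trans_lt hR
  have hid : HasLogOn (fun z : ℂ => z) (Metric.sphere 0 R) := by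
    have h1 : HasLogOn (fun z : ℂ => z / (z - p)) (Metric.sphere 0 R) := by
      have hz : ∀ z ∈ Metric.sphere (0 : ℂ) R, z ≠ 0 ∧ z - p ≠ 0 ∧ ‖p / z‖ < 1 := by
        intro z hz
        rw [mem_sphere_zero_iff_norm] at hz
        have hz0 : z ≠ 0 := norm_pos_iff.1 (hz ▸ hR0)
        refine ⟨hz0, sub_ne_zero.2 (by rintro rfl; linarith), ?_⟩
        rw [norm_div, hz, div_lt_one hR0]
        exact hR
      have h2 : HasLogOn (fun z : ℂ => (z - p) / z) (Metric.sphere 0 R) := by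
        refine hasLogOn_of_slitPlane
          (ContinuousOn.div (by fun_prop) (by fun_prop) fun z h => (hz z h).1) 1
          fun z h => Or.inl ?_
        have h3 : 1 * ((z - p) / z) = 1 - p / z := by
          have := (hz z h).1
          field_simp
        rw [h3, Complex.sub_re, Complex.one_re]
        linarith [(Complex.re_le_norm (p / z)), (hz z h).2.2]
      obtain ⟨g, hg, he⟩ := h2
      refine ⟨-g, hg.neg, fun z hzs => ?_⟩
      rw [Pi.neg_apply, Complex.exp_neg, he z hzs, inv_div]
    refine (h.mul h1).congr fun z hz => ?_
    have : z - p ≠ 0 := sub_ne_zero.2 (by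
      rintro rfl; rw [mem_sphere_zero_iff_norm] at hz; linarith)
    field_simp
  obtain ⟨g, hg, he⟩ := hid
  let γ : ℝ → ℂ := fun t => R * Complex.exp (t * Complex.I)
  have hγ : Continuous γ := by fun_prop
  have hγs : ∀ t, γ t ∈ Metric.sphere (0 : ℂ) R := fun t => by
    rw [mem_sphere_zero_iff_norm, norm_mul, Complex.norm_exp_ofReal_mul_I, Complex.norm_real,
      mul_one, Real.norm_of_nonneg hR0.le]
  have hd : Continuous fun t : ℝ => g (γ t) - t * Complex.I := by
    refine Continuous.sub ?_ (by fun_prop)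
    exact hg.comp_continuous hγ hγs
  have hconst : ∀ t : ℝ, Complex.exp (g (γ t) - t * Complex.I) = R := fun t => by
    rw [Complex.exp_sub, he _ (hγs t)]
    exact mul_div_cancel_right₀ _ (Complex.exp_ne_zero _)
  have hint : ∀ t : ℝ, ∃ n : ℤ, g (γ t) - t * Complex.I =
      g (γ 0) - (0 : ℝ) * Complex.I + n * (2 * Real.pi * Complex.I) := fun t =>
    Complex.exp_eq_exp_iff_exists_int.1 ((hconst t).trans (hconst 0).symm)
  choose n hn using hint
  have hnc : Continuous n := by
    have h1 : Continuous fun t : ℝ => ((g (γ t) - t * Complex.I -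
        (g (γ 0) - (0 : ℝ) * Complex.I)) / (2 * Real.pi * Complex.I)).re :=
      Complex.continuous_re.comp ((hd.sub continuous_const).div_const _)
    refine Int.isClosedEmbedding_coe_real.isInducing.continuous_iff.2 (h1.congr fun t => ?_)
    rw [hn t, add_sub_cancel_left, mul_div_cancel_right₀ _ Complex.two_pi_I_ne_zero]
    simp
  have h2 : n (2 * Real.pi) = n 0 := PreconnectedSpace.constant inferInstance hnc
  have h3 := hn (2 * Real.pi)
  have h4 := hn 0
  have hγ2 : γ (2 * Real.pi) = γ 0 := by
    simp only [γ]
    push_cast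
    rw [Complex.exp_two_pi_mul_I]
    simp
  rw [h2, hγ2] at h3
  apply Complex.two_pi_I_ne_zero
  push_cast at h3 h4
  linear_combination h4 - h3

/-- If a compact set separates the plane, then some linear function without zeros on it has no
logarithm on it. -/
theorem exists_not_hasLogOn_sub {K : Set ℂ} (hK : IsCompact K) (hc : ¬ IsPreconnected Kᶜ) :
    ∃ p ∉ K, ¬ HasLogOn (fun z => z - p) K := by
  by_contra! hlog
  have hKo : IsOpen Kᶜ := hK.isClosed.isOpen_compl
  obtain ⟨R, hR⟩ := hK.isBounded.exists_norm_le
  have hout : {z : ℂ | R < ‖z‖} ⊆ Kᶜ := fun z hz hzK => absurd (hR z hzK) (not_le.2 hz)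
  -- For `p` in a bounded piece `U`, extend the logarithm of `z - p` from `K` to the plane by
  -- Tietze. Its exponential on `U`, continued by `z - p` outside `U`, is zero-free on the plane, so
  -- it has a logarithm on large discs; hence `z - p` has one on large circles.
  have key : ∀ U V : Set ℂ, IsOpen U → IsOpen V → U ⊆ Kᶜ → Kᶜ ⊆ U ∪ V → Disjoint U V →
      {z : ℂ | R < ‖z‖} ⊆ V → U = ∅ := by
    intro U V hU hV hUK hUV hdis hRV
    by_contra hne
    obtain ⟨p, hpU⟩ := nonempty_iff_ne_empty.2 hne
    obtain ⟨g, hg, he⟩ := hlog p (hUK hpU)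
    obtain ⟨G, hG⟩ := ContinuousMap.exists_restrict_eq hK.isClosed
      ⟨K.domRestrict g, continuousOn_iff_continuous_domRestrict.1 hg⟩
    have hGg : ∀ z ∈ K, G z = g z := fun z hz => DFunLike.congr_fun hG ⟨z, hz⟩
    have hcU : IsClosed (U ∪ K) := by
      have : U ∪ K = (V \ K)ᶜ := by
        ext z
        constructor
        · rintro (hz | hz) ⟨hzV, hzK⟩
          · exact disjoint_left.1 hdis hz hzV
          · exact hzK hz
        · intro hz
          by_cases hzK : z ∈ K
          · exact Or.inr hzK
          · exact (hUV hzK).imp_right fun hzV => absurd ⟨hzV, hzK⟩ hz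
      rw [this]
      exact (hV.sdiff hK.isClosed).isClosed_compl
    have hcV : IsClosed Uᶜ := hU.isClosed_compl
    obtain ⟨k, hk, hk1, hk2⟩ := exists_continuousOn_union_of_isClosed hcU hcV
      (g := fun z => Complex.exp (G z)) (g' := fun z => z - p) (by fun_prop) (by fun_prop)
      fun z hz => by
        have hzK : z ∈ K := hz.1.resolve_left hz.2
        rw [hGg z hzK, he z hzK]
    have hun : U ∪ K ∪ Uᶜ = univ := by
      rw [union_right_comm, union_compl_self, univ_union]
    rw [hun] at hk
    have hk' : Continuous k := continuousOn_univ.1 hk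
    have hk0 : ∀ z, k z ≠ 0 := fun z => by
      by_cases hz : z ∈ U
      · rw [hk1 (Or.inl hz)]
        exact Complex.exp_ne_zero _
      · rw [hk2 hz]
        exact sub_ne_zero.2 (by rintro rfl; exact hz hpU)
    set r := max R ‖p‖ + 1 with hr
    refine not_hasLogOn_sub_sphere (R := r) (p := p) (by linarith [le_max_right R ‖p‖])
      (((hasLogOn_closedBall r hk' hk0).mono Metric.sphere_subset_closedBall).congr fun z hz => ?_)
    refine hk2 fun hzU => disjoint_left.1 hdis hzU (hRV ?_)
    rw [mem_sphere_zero_iff_norm] at hz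
    change R < ‖z‖
    linarith [le_max_left R ‖p‖]
  refine hc ?_
  intro U V hU hV hUV hUne hVne
  by_contra hemp
  rw [not_nonempty_iff_eq_empty] at hemp
  have hdis : Disjoint (Kᶜ ∩ U) (Kᶜ ∩ V) := by
    rw [Set.disjoint_iff_inter_eq_empty, ← inter_inter_distrib_left, hemp]
  have hcov : Kᶜ ⊆ Kᶜ ∩ U ∪ Kᶜ ∩ V := fun z hz => (hUV hz).imp (⟨hz, ·⟩) (⟨hz, ·⟩)
  have hcase := (isPreconnected_norm_gt R).subset_or_subset (hKo.inter hU) (hKo.inter hV) hdis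
    (hout.trans hcov)
  rcases hcase with h | h
  · exact hVne.ne_empty (key _ _ (hKo.inter hV) (hKo.inter hU) inter_subset_left
      (by rwa [union_comm]) hdis.symm h)
  · exact hUne.ne_empty (key _ _ (hKo.inter hU) (hKo.inter hV) inter_subset_left hcov hdis h)

/-! ### Monotone maps -/

section Monotone

variable {X Y : Type*} [TopologicalSpace X] [TopologicalSpace Y] {f : X → Y}

theorem IsClosedMap.isOpen_setOf_preimage_subset (hf : IsClosedMap f) {U : Set X}
    (hU : IsOpen U) : IsOpen {y | f ⁻¹' {y} ⊆ U} := by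
  have : {y | f ⁻¹' {y} ⊆ U} = (f '' Uᶜ)ᶜ := by
    ext y
    constructor
    · rintro h ⟨x, hx, rfl⟩
      exact hx (h rfl)
    · intro h x hx
      by_contra hxU
      exact h ⟨x, hxU, hx⟩
  rw [this]
  exact (hf _ hU.isClosed_compl).isOpen_compl

/-- Each connected fibre lies in one side of a closed separation of the preimage, so the images of
the two sides are disjoint closed sets separating `K`. -/
theorem IsMonotoneMap.isPreconnected_preimage (hm : IsMonotoneMap f) (hf : IsClosedMap f)
    (hc : Continuous f) {K : Set Y} (hK : IsPreconnected K) (hKc : IsClosed K)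
    (hsurj : Function.Surjective f) : IsPreconnected (f ⁻¹' K) := by
  rw [isPreconnected_iff_subset_of_disjoint_closed]
  intro u v hu hv huv hdis
  have hu' : IsClosed (f ⁻¹' K ∩ u) := (hKc.preimage hc).inter hu
  have hv' : IsClosed (f ⁻¹' K ∩ v) := (hKc.preimage hc).inter hv
  have hfib : ∀ y ∈ K, f ⁻¹' {y} ⊆ u ∨ f ⁻¹' {y} ⊆ v := fun y hy => by
    have hsub : f ⁻¹' {y} ⊆ f ⁻¹' K := preimage_mono (singleton_subset_iff.2 hy)
    refine isPreconnected_iff_subset_of_disjoint_closed.1 (hm y) u v hu hv (hsub.trans huv) ?_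
    exact subset_empty_iff.1 fun x hx => hdis ▸ ⟨hsub hx.1, hx.2⟩
  have hKuv : K ⊆ f '' (f ⁻¹' K ∩ u) ∪ f '' (f ⁻¹' K ∩ v) := fun y hy => by
    obtain ⟨x, rfl⟩ := hsurj y
    exact (huv hy).imp (fun hx => ⟨x, ⟨hy, hx⟩, rfl⟩) (fun hx => ⟨x, ⟨hy, hx⟩, rfl⟩)
  have hdis' : K ∩ (f '' (f ⁻¹' K ∩ u) ∩ f '' (f ⁻¹' K ∩ v)) = ∅ := by
    rw [eq_empty_iff_forall_notMem]
    rintro y ⟨hy, ⟨x, hx, rfl⟩, ⟨x', hx', hxx⟩⟩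
    rcases hfib _ hy with h | h
    · exact hdis.le ⟨hx'.1, h hxx, hx'.2⟩
    · exact hdis.le ⟨hx.1, hx.2, h rfl⟩
  refine (isPreconnected_iff_subset_of_disjoint_closed.1 hK _ _ (hf _ hu') (hf _ hv') hKuv
    hdis').imp (fun h x hx => ?_) (fun h x hx => ?_)
  · obtain ⟨x', hx', hxx⟩ := h hx
    refine (hfib _ hx).resolve_right (fun hsub => ?_) rfl
    exact hdis.le ⟨hx'.1, hx'.2, hsub hxx⟩
  · obtain ⟨x', hx', hxx⟩ := h hx
    refine (hfib _ hx).resolve_left (fun hsub => ?_) rfl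
    exact hdis.le ⟨hx'.1, hsub hxx, hx'.2⟩

/-- If a function without zeros on the domain of a monotone map has logarithms near all fibres,
then, up to a factor with a logarithm, it comes from a function on the target. -/
theorem IsMonotoneMap.exists_eq_comp_mul_exp [CompactSpace Y] [T2Space Y]
    (hm : IsMonotoneMap f) (hf : IsClosedMap f) (hc : Continuous f)
    (hsurj : Function.Surjective f) {k : X → ℂ} (hk : Continuous k)
    (hlog : ∀ y, ∃ U, IsOpen U ∧ f ⁻¹' {y} ⊆ U ∧ HasLogOn k U) :
    ∃ (h : Y → ℂ) (u : X → ℂ), Continuous h ∧ Continuous u ∧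
      ∀ x, k x = h (f x) * Complex.exp (u x) := by
  choose U hUo hfU hU using hlog
  choose g hg he using hU
  let W : Y → Set Y := fun y => {z | f ⁻¹' {z} ⊆ U y}
  have hW : ∀ y, IsOpen (W y) := fun y => hf.isOpen_setOf_preimage_subset (hUo y)
  have hWU : ∀ y x, f x ∈ W y → x ∈ U y := fun y x hx => hx rfl
  obtain ⟨t, ht⟩ := isCompact_univ.elim_finite_subcover W hW
    fun y _ => mem_iUnion.2 ⟨y, hfU y⟩
  obtain ⟨ψ, hψ⟩ := PartitionOfUnity.exists_isSubordinate isClosed_univ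
    (fun i : t => W i) (fun i => hW i) (fun y hy => by
      obtain ⟨i, hi, hy'⟩ := mem_iUnion₂.1 (ht hy)
      exact mem_iUnion.2 ⟨⟨i, hi⟩, hy'⟩)
  have hψ1 : ∀ y, ∑ i, ψ i y = 1 := fun y => by
    rw [← finsum_eq_sum_of_fintype]
    exact ψ.sum_eq_one (mem_univ y)
  have hψ0 : ∀ (i : t) y, y ∉ W i → ψ i y = 0 := fun i y hy => by
    by_contra hne
    exact hy (hψ i (subset_tsupport _ hne))
  -- An average of the local logarithms, with weights that are constant on fibres.
  let u : X → ℂ := fun x => ∑ i : t, (ψ i (f x) : ℂ) * g i x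
  have hu : Continuous u := by
    refine continuous_finsetSum _ fun i _ => continuous_iff_continuousAt.2 fun x => ?_
    by_cases hx : f x ∈ tsupport (ψ i)
    · have h1 : ContinuousAt (g i) x :=
        (hg i).continuousAt ((hUo i).mem_nhds (hWU _ _ (hψ i hx)))
      have h2 : Continuous fun x => (ψ i (f x) : ℂ) :=
        Complex.continuous_ofReal.comp ((ψ i).continuous.comp hc)
      exact h2.continuousAt.mul h1
    · have hop : IsOpen (f ⁻¹' (tsupport (ψ i))ᶜ) :=
        (isClosed_tsupport _).isOpen_compl.preimage hc
      refine (continuousAt_const (y := (0 : ℂ))).congr ?_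
      filter_upwards [hop.mem_nhds hx] with z hz
      rw [image_eq_zero_of_notMem_tsupport hz]
      simp
  have hconst : ∀ x x', f x = f x' →
      k x * Complex.exp (-u x) = k x' * Complex.exp (-u x') := by
    intro x x' hxx
    -- On a connected fibre two logarithms of `k` differ by a constant, so there `u` differs from
    -- any one of them by a constant.
    have hdiff : ∀ i j : Y, f x ∈ W i → f x ∈ W j → g i x - g j x = g i x' - g j x' := by
      intro i j hi hj
      have hcont : ContinuousOn (fun z => ((g i z - g j z) / (2 * Real.pi * Complex.I)).re)
          (f ⁻¹' {f x}) :=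
        Complex.continuous_re.comp_continuousOn
          ((((hg i).mono hi).sub ((hg j).mono hj)).div_const _)
      have hex : ∀ z, ∃ n : ℤ, z ∈ f ⁻¹' {f x} → g i z - g j z = n * (2 * Real.pi * Complex.I) := by
        intro z
        by_cases hz : z ∈ f ⁻¹' {f x}
        · obtain ⟨n, hn⟩ := Complex.exp_eq_exp_iff_exists_int.1
            ((he i z (hi hz)).trans (he j z (hj hz)).symm)
          exact ⟨n, fun _ => by rw [hn]; ring⟩
        · exact ⟨0, fun h => absurd h hz⟩
      choose n hn using hex
      have hnc : ContinuousOn n (f ⁻¹' {f x}) := by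
        refine Int.isClosedEmbedding_coe_real.isInducing.continuousOn_iff.2
          (hcont.congr fun z hz => ?_)
        simp only [hn z hz, mul_div_cancel_right₀ _ Complex.two_pi_I_ne_zero, Complex.intCast_re]
        rfl
      have hxf : x ∈ f ⁻¹' {f x} := rfl
      have hxf' : x' ∈ f ⁻¹' {f x} := hxx.symm
      rw [hn x hxf, hn x' hxf', (hm (f x)).constant hnc hxf hxf']
    obtain ⟨i₀, hi₀⟩ : ∃ i, f x ∈ W i := ⟨f x, hfU _⟩
    have huu : u x - g i₀ x = u x' - g i₀ x' := by
      have hsum : ∀ z, f z = f x →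
          u z - g i₀ z = ∑ i : t, (ψ i (f x) : ℂ) * (g i z - g i₀ z) := by
        intro z hz
        have h1 : ∑ i : t, (ψ i (f x) : ℂ) = 1 := by
          rw [← Complex.ofReal_sum, hψ1, Complex.ofReal_one]
        simp only [mul_sub, Finset.sum_sub_distrib, ← Finset.sum_mul, h1, one_mul, u, hz]
      rw [hsum x rfl, hsum x' hxx.symm]
      refine Finset.sum_congr rfl fun i _ => ?_
      by_cases hi : f x ∈ W i
      · rw [hdiff i i₀ hi hi₀]
      · rw [hψ0 i _ hi]; simp
    rw [← he i₀ x (hi₀ rfl), ← he i₀ x' (hi₀ hxx.symm), ← Complex.exp_add, ← Complex.exp_add]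
    congr 1
    linear_combination -huu
  have hquot : Topology.IsQuotientMap f := hf.isQuotientMap hc hsurj
  -- The section `s` need not be continuous; continuity of `h` comes from the quotient map.
  choose s hs using hsurj
  have hfac : ∀ x, k (s (f x)) * Complex.exp (-u (s (f x))) = k x * Complex.exp (-u x) :=
    fun x => hconst _ _ (hs _)
  refine ⟨fun y => k (s y) * Complex.exp (-u (s y)), u, ?_, hu, fun x => ?_⟩
  · rw [hquot.continuous_iff]
    have : Continuous fun x => k x * Complex.exp (-u x) := by fun_prop
    exact this.congr fun x => (hfac x).symm
  · change k x = k (s (f x)) * Complex.exp (-u (s (f x))) * _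
    rw [hfac, mul_assoc, ← Complex.exp_add, neg_add_cancel, Complex.exp_zero, mul_one]

end Monotone

/-! ### Transfer of the logarithm obstruction and of indecomposability -/

/-- On a circle-like compact space a function without zeros has a logarithm near every proper
closed subset. -/
theorem IsCircleLike.exists_hasLogOn {X : Type*} [MetricSpace X] [CompactSpace X]
    (hX : IsCircleLike X) {k : X → ℂ} (hk : Continuous k) (h0 : ∀ x, k x ≠ 0) {F : Set X}
    (hF : IsClosed F) (hne : F ≠ univ) : ∃ U, IsOpen U ∧ F ⊆ U ∧ HasLogOn k U := by
  classical
  obtain ⟨x₀, hx₀⟩ := (ne_univ_iff_exists_notMem F).1 hne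
  obtain ⟨ε, hε, hball⟩ := Metric.isOpen_iff.1 hF.isOpen_compl x₀ hx₀
  obtain ⟨δ, hδ, hsmall⟩ := exists_forall_dist_lt_ratio isCompact_univ hk.continuousOn
    fun x _ => h0 x
  obtain ⟨m, D, hD, hcov, hdiam⟩ := hX (min ε δ) (lt_min hε hδ)
  have hm := hD.three_le
  have : NeZero m := ⟨by omega⟩
  have hdist : ∀ l, ∀ x ∈ D l, ∀ y ∈ D l, dist x y < min ε δ := fun l x hx y hy =>
    (Metric.dist_le_diam_of_mem (isCompact_univ.isBounded.subset (subset_univ _)) hx hy).trans_lt (hdiam l)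
  obtain ⟨l, hl⟩ := mem_iUnion.1 (hcov ▸ mem_univ x₀)
  -- The link around `x₀` has diameter less than `ε` and so misses `F`; emptying it breaks the
  -- circle.
  let D' : ZMod m → Set X := Function.update D l ∅
  have hsub : ∀ i, D' i ⊆ D i := fun i => by
    rcases eq_or_ne i l with rfl | hi
    · simp [D']
    · simp [D', hi]
  have hopen : ∀ i, IsOpen (D' i) := fun i => by
    rcases eq_or_ne i l with rfl | hi
    · simp [D']
    · simpa [D', hi] using hD.isOpen_link i
  refine ⟨⋃ i, D' i, isOpen_iUnion hopen, fun x hx => ?_,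
    hasLogOn_of_broken_cyclic_chain D' hopen (fun i j h => ?_) l (by simp [D']) fun i => ?_⟩
  · obtain ⟨i, hi⟩ := mem_iUnion.1 (hcov ▸ mem_univ x)
    have hil : i ≠ l := by
      rintro rfl
      exact hball (Metric.mem_ball.2 ((hdist i x hi x₀ hl).trans_le (min_le_left _ _))) hx
    exact mem_iUnion.2 ⟨i, by simpa [D', hil] using hi⟩
  · exact (hD.inter_nonempty_iff i j).1 (h.mono (inter_subset_inter (hsub i) (hsub j)))
  · exact (hasSmallLogOn_of_ratio hk.continuousOn (fun x _ => h0 x) fun x hx y hy =>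
      hsmall x (mem_univ _) y (mem_univ _)
        ((hdist i x hx y hy).trans_le (min_le_right _ _))).mono (hsub i)

/-- Nondegenerate monotone images of circle-like compact spaces that admit a function without
zeros and without a logarithm admit such a function too. -/
theorem IsMonotoneMap.exists_not_hasLogOn {X Y : Type*} [MetricSpace X] [CompactSpace X]
    [MetricSpace Y] [Nontrivial Y] {f : X → Y} (hm : IsMonotoneMap f) (hc : Continuous f)
    (hsurj : Function.Surjective f) (hX : IsCircleLike X) {k : X → ℂ} (hk : Continuous k)
    (h0 : ∀ x, k x ≠ 0) (hlog : ¬ HasLogOn k univ) :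
    ∃ h : Y → ℂ, Continuous h ∧ (∀ y, h y ≠ 0) ∧ ¬ HasLogOn h univ := by
  have : CompactSpace Y := hsurj.compactSpace hc
  obtain ⟨h, u, hh, hu, hku⟩ := hm.exists_eq_comp_mul_exp hc.isClosedMap hc hsurj hk fun y =>
    hX.exists_hasLogOn hk h0 (isClosed_singleton.preimage hc) fun huniv => by
      obtain ⟨y', hy'⟩ := exists_ne y
      obtain ⟨x, rfl⟩ := hsurj y'
      exact hy' (huniv ▸ mem_univ x : x ∈ f ⁻¹' {y})
  refine ⟨h, hh, fun y hy => ?_, fun hl => hlog ?_⟩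
  · obtain ⟨x, rfl⟩ := hsurj y
    exact h0 x (by rw [hku, hy, zero_mul])
  · have h1 : HasLogOn (fun x => Complex.exp (u x)) univ := ⟨u, hu.continuousOn, fun _ _ => rfl⟩
    exact ((hl.comp hc.continuousOn (mapsTo_univ _ _)).mul h1).congr fun x _ => (hku x).symm

theorem IsPlaneSeparating.exists_not_hasLogOn {X : Type*} [MetricSpace X] [CompactSpace X]
    (hX : IsPlaneSeparating X) :
    ∃ k : X → ℂ, Continuous k ∧ (∀ x, k x ≠ 0) ∧ ¬ HasLogOn k univ := by
  obtain ⟨e, he, hsep⟩ := hX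
  obtain ⟨p, hp, hlog⟩ := exists_not_hasLogOn_sub (isCompact_range he.continuous) hsep
  refine ⟨fun x => e x - p, by fun_prop, fun x hx => hp ⟨x, sub_eq_zero.1 hx⟩, fun h => hlog ?_⟩
  obtain ⟨g, hg, hge⟩ := h
  rcases isEmpty_or_nonempty X with hemp | hne
  · exact ⟨0, by simp [range_eq_empty], by simp⟩
  let s := Function.invFun e
  have hs : ∀ x, s (e x) = x := Function.leftInverse_invFun he.injective
  refine ⟨fun z => g (s z), ?_, ?_⟩
  · refine (continuousOn_univ.1 hg).comp_continuousOn ?_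
    rw [he.isInducing.continuousOn_iff]
    refine continuousOn_id.congr ?_
    rintro _ ⟨x, rfl⟩
    simp [hs]
  · rintro _ ⟨x, rfl⟩
    simpa [hs] using hge x (mem_univ x)

theorem isPlaneSeparating_of_not_hasLogOn {X : Type*} [MetricSpace X] [CompactSpace X]
    {e : X → ℂ} (he : Topology.IsEmbedding e) {k : X → ℂ} (hk : Continuous k)
    (h0 : ∀ x, k x ≠ 0) (hlog : ¬ HasLogOn k univ) : IsPlaneSeparating X := by
  refine ⟨e, he, fun hcon => hlog ?_⟩
  rcases isEmpty_or_nonempty X with hemp | hne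
  · exact ⟨0, continuousOn_const, fun x => hemp.elim x⟩
  let s := Function.invFun e
  have hs : ∀ x, s (e x) = x := Function.leftInverse_invFun he.injective
  have hsc : ContinuousOn s (range e) := by
    rw [he.isInducing.continuousOn_iff]
    refine continuousOn_id.congr ?_
    rintro _ ⟨x, rfl⟩
    simp [hs]
  have h := hasLogOn_of_isPreconnected_compl (isCompact_range he.continuous) hcon
    (hk.comp_continuousOn hsc) (fun z _ => h0 _)
  refine (h.comp he.continuous.continuousOn fun x _ => mem_range_self x).congr fun x _ => ?_
  simp [hs]

theorem IsMonotoneMap.isHereditarilyIndecomposable {X Y : Type*} [MetricSpace X] [CompactSpace X]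
    [MetricSpace Y] {f : X → Y} (hm : IsMonotoneMap f) (hc : Continuous f)
    (hsurj : Function.Surjective f) (hX : IsHereditarilyIndecomposable X) :
    IsHereditarilyIndecomposable Y := by
  have hpre : ∀ K : Set Y, IsContinuum K → IsContinuum (f ⁻¹' K) := fun K hK =>
    ⟨(hK.1.isClosed.preimage hc).isCompact, hK.2.nonempty.preimage hsurj,
      hm.isPreconnected_preimage hc.isClosedMap hc hK.2.isPreconnected hK.1.isClosed hsurj⟩
  rintro K hK ⟨A, B, hA, hB, hAK, hBK, rfl⟩
  exact hX _ (hpre _ hK) ⟨f ⁻¹' A, f ⁻¹' B, hpre _ hA, hpre _ hB,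
    fun h => hAK (hsurj.preimage_injective h), fun h => hBK (hsurj.preimage_injective h), rfl⟩

/-! ### Grouping the links of a cyclic family -/

/-- Take a set of cuts with the most elements among those whose consecutive members are unrelated;
`{0, j, m}` is a candidate. An index between consecutive cuts related to neither could be added. -/
theorem exists_maximal_cuts (m : ℕ) (R : ℕ → ℕ → Prop) {j : ℕ} (hj0 : 0 < j) (hjm : j < m)
    (hR0 : ¬ R 0 j) (hRm : ¬ R j m) :
    ∃ S : Finset ℕ, (∀ c ∈ S, c ≤ m) ∧ 0 ∈ S ∧ m ∈ S ∧
      ∀ c ∈ S, ∀ c' ∈ S, c < c' → (∀ i ∈ S, i ≤ c ∨ c' ≤ i) →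
        ¬ R c c' ∧ ∀ i, c < i → i < c' → R c i ∨ R i c' := by
  classical
  let good : Finset ℕ → Prop := fun S => 0 ∈ S ∧ m ∈ S ∧
    ∀ c ∈ S, ∀ c' ∈ S, c < c' → (∀ i ∈ S, i ≤ c ∨ c' ≤ i) → ¬ R c c'
  let 𝒮 := (Finset.range (m + 1)).powerset.filter good
  have h𝒮 : 𝒮.Nonempty := by
    refine ⟨{0, j, m}, ?_⟩
    simp only [𝒮, good, Finset.mem_filter, Finset.mem_powerset]
    refine ⟨?_, by simp, by simp, ?_⟩
    · intro i hi
      simp only [Finset.mem_insert, Finset.mem_singleton] at hi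
      rw [Finset.mem_range]
      omega
    · intro c hc c' hc' hlt hcon
      have hconj := hcon j (by simp)
      simp only [Finset.mem_insert, Finset.mem_singleton] at hc hc'
      rcases hc with rfl | rfl | rfl <;> rcases hc' with rfl | rfl | rfl <;>
        omega
  obtain ⟨S, hS, hmax⟩ := Finset.exists_max_image 𝒮 Finset.card h𝒮
  simp only [𝒮, good, Finset.mem_filter, Finset.mem_powerset] at hS hmax
  obtain ⟨hSm, h0, hm, hgood⟩ := hS
  refine ⟨S, fun c hc => by have := Finset.mem_range.1 (hSm hc); omega, h0, hm,
    fun c hc c' hc' hlt hcon => ⟨hgood c hc c' hc' hlt hcon, fun i hi hi' => ?_⟩⟩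
  by_contra! hcontra
  have hiS : i ∉ S := fun h => by have := hcon i h; omega
  have hins : insert i S ⊆ Finset.range (m + 1) := by
    refine Finset.insert_subset ?_ hSm
    have := Finset.mem_range.1 (hSm hc')
    exact Finset.mem_range.2 (by omega)
  have := hmax (insert i S) ⟨hins, Finset.mem_insert_of_mem h0, Finset.mem_insert_of_mem hm, ?_⟩
  · rw [Finset.card_insert_of_notMem hiS] at this
    omega
  · intro d hd d' hd' hdd hdcon
    have hdi := hdcon i (Finset.mem_insert_self _ _)
    have hdc := hdcon c (Finset.mem_insert_of_mem hc)
    have hdc' := hdcon c' (Finset.mem_insert_of_mem hc')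
    rcases Finset.mem_insert.1 hd with rfl | hdS <;> rcases Finset.mem_insert.1 hd' with rfl | hdS'
    · omega
    · have := hcon d' hdS'
      obtain rfl : d' = c' := by omega
      exact hcontra.2
    · have := hcon d hdS
      obtain rfl : d = c := by omega
      exact hcontra.1
    · exact hgood d hdS d' hdS' hdd fun k hk => hdcon k (Finset.mem_insert_of_mem hk)

/-- The indices of a cyclic family with a proximity relation `R` can be cut into blocks: `S` is the
set of cuts, `a` numbers the blocks (each of which starts with a cut), consecutive cuts are not
near each other, and all indices of a block are linked by `R` to the cuts at its two ends. -/
theorem exists_cyclic_blocks {m : ℕ} [NeZero m] (R : ZMod m → ZMod m → Prop)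
    (hrefl : ∀ i, R i i) (hsymm : ∀ i j, R i j → R j i) (hsucc : ∀ i, R i (i + 1))
    {j : ZMod m} (hj : ¬ R 0 j) :
    ∃ (N : ℕ) (_ : NeZero N) (a : ZMod m → ZMod N) (S : Set (ZMod m)),
      (∀ i, (i + 1 ∉ S ∧ a (i + 1) = a i) ∨ (i + 1 ∈ S ∧ i ∉ S ∧ a (i + 1) = a i + 1)) ∧
      (∀ c ∈ S, ∀ c' ∈ S, a c' = a c + 1 → ¬ R c c') ∧
      (∀ c ∈ S, ∀ c' ∈ S, a c = a c' → c = c') ∧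
      (∀ i ∉ S, ∃ c ∈ S, ∃ c' ∈ S, a c = a i ∧ a c' = a i + 1 ∧ (R c i ∨ R i c') ∧
        ∃ p q, R c p ∧ R p q ∧ R q c') := by
  classical
  have hmpos : 0 < m := Nat.pos_of_ne_zero (NeZero.ne m)
  have hj0 : 0 < j.val := by
    rw [Nat.pos_iff_ne_zero, Ne, ZMod.val_eq_zero]
    rintro rfl
    exact hj (hrefl 0)
  obtain ⟨S, hSm, h0S, hmS, hS⟩ := exists_maximal_cuts m
    (fun i j => R (i : ZMod m) (j : ZMod m)) hj0 (ZMod.val_lt j) (by simpa using hj)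
    (fun h => hj (hsymm _ _ (by simpa using h)))
  -- `A i` counts the cuts up to `i`. As `A 0 = 1` and `A m = N + 1`, it closes up modulo `N` when
  -- `m` is identified with `0`.
  let A : ℕ → ℕ := fun i => (S.filter (· ≤ i)).card
  have hAmono : ∀ i i', i ≤ i' → A i ≤ A i' := fun i i' h =>
    Finset.card_le_card fun c hc => by
      simp only [Finset.mem_filter] at hc ⊢
      exact ⟨hc.1, hc.2.trans h⟩
  have hAlt : ∀ i, ∀ c ∈ S, i < c → A i < A c := fun i c hc h =>
    Finset.card_lt_card ⟨fun d hd => by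
      simp only [Finset.mem_filter] at hd ⊢
      exact ⟨hd.1, hd.2.trans h.le⟩, fun hsub => by
      have := hsub (Finset.mem_filter.2 ⟨hc, le_rfl⟩)
      simp only [Finset.mem_filter] at this
      omega⟩
  have hAsucc : ∀ i, ∀ c' ∈ S, i < c' → (∀ d ∈ S, d ≤ i ∨ c' ≤ d) → A c' = A i + 1 := by
    intro i c' hc' hlt hcon
    have : S.filter (· ≤ c') = insert c' (S.filter (· ≤ i)) := by
      ext d
      simp only [Finset.mem_filter, Finset.mem_insert]
      constructor
      · rintro ⟨hd, hle⟩
        have := hcon d hd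
        by_cases hdc : d = c'
        · exact Or.inl hdc
        · exact Or.inr ⟨hd, by omega⟩
      · rintro (rfl | ⟨hd, hle⟩)
        · exact ⟨hc', le_rfl⟩
        · exact ⟨hd, by omega⟩
    change (S.filter (· ≤ c')).card = _
    rw [this, Finset.card_insert_of_notMem]
    simp only [Finset.mem_filter]
    omega
  have hAeq : ∀ c i, c ≤ i → (∀ d ∈ S, d ≤ c ∨ i < d) → A c = A i := by
    intro c i hci hcon
    refine congrArg Finset.card (Finset.filter_congr fun d hd => ?_)
    have := hcon d hd
    omega
  have hA0 : A 0 = 1 := by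
    have : S.filter (· ≤ 0) = {0} := by
      ext d
      simp only [Finset.mem_filter, Finset.mem_singleton]
      constructor
      · rintro ⟨-, h⟩; omega
      · rintro rfl; exact ⟨h0S, le_rfl⟩
    change (S.filter (· ≤ 0)).card = _
    rw [this, Finset.card_singleton]
  obtain ⟨N, hN⟩ : ∃ N, A m = N + 1 := ⟨A m - 1, by have := hAmono 0 m (by omega); omega⟩
  have hN0 : 0 < N := by have := hAlt 0 m hmS hmpos; omega
  have : NeZero N := ⟨hN0.ne'⟩
  have hA1 : ∀ i, 1 ≤ A i := fun i => hA0 ▸ hAmono 0 i (by omega)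
  have hAN : ∀ i, i < m → A i ≤ N := fun i hi => by have := hAlt i m hmS hi; omega
  have hAinj : ∀ c ∈ S, ∀ c' ∈ S, A c = A c' → c = c' := fun c hc c' hc' h => by
    rcases lt_trichotomy c c' with hlt | heq | hlt
    · have := hAlt c c' hc' hlt; omega
    · exact heq
    · have := hAlt c' c hc hlt; omega
  have hval : ∀ v, v < m → ((v : ℕ) : ZMod m).val = v := fun v hv => ZMod.val_cast_of_lt hv
  let a : ZMod m → ZMod N := fun z => (A z.val : ZMod N)
  have hcast : ∀ v ∈ S, ((v : ℕ) : ZMod m).val ∈ S ∧ a (v : ZMod m) = (A v : ZMod N) := by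
    intro v hv
    rcases (hSm v hv).lt_or_eq with h | rfl
    · simp only [a, hval v h]
      exact ⟨hv, trivial⟩
    · simp [a, hA0, hN, h0S]
  have hcons : ∀ v ∈ S, v + 1 ∈ S → False := fun v hv hv' =>
    (hS v hv (v + 1) hv' (by omega) fun i _ => by omega).1 (by simpa using hsucc (v : ZMod m))
  have hcongr : ∀ x y, 1 ≤ x → x ≤ N → 1 ≤ y → y ≤ N → (x : ZMod N) = (y : ZMod N) → x = y := by
    intro x y hx hxN hy hyN h
    rw [ZMod.natCast_eq_natCast_iff] at h
    have h1 := (Nat.modEq_iff_dvd.1 h)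
    have := Int.eq_zero_of_abs_lt_dvd h1 (by rw [abs_lt]; omega)
    omega
  refine ⟨N, this, a, {z : ZMod m | z.val ∈ S}, fun z => ?_, fun c hc c' hc' hac => ?_,
    fun c hc c' hc' hac => ?_, fun z hz => ?_⟩
  · have hz : ((z.val + 1 : ℕ) : ZMod m) = z + 1 := by simp
    have hzlt := ZMod.val_lt z
    have haz : a z = (A z.val : ZMod N) := rfl
    by_cases hmem : z.val + 1 ∈ S
    · refine Or.inr ⟨?_, fun h => hcons _ h hmem, ?_⟩
      · rw [← hz]
        exact (hcast _ hmem).1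
      · rw [← hz, (hcast _ hmem).2, hAsucc z.val _ hmem (by omega) fun d _ => by omega]
        push_cast
        rfl
    · have hlt : z.val + 1 < m := by
        by_contra! hge
        have heq : z.val + 1 = m := by omega
        exact hmem (by rw [heq]; exact hmS)
      refine Or.inl ⟨?_, ?_⟩
      · rw [← hz]
        change ¬ (((z.val + 1 : ℕ) : ZMod m).val ∈ S)
        rwa [hval _ hlt]
      · rw [← hz]
        change ((A ((z.val + 1 : ℕ) : ZMod m).val : ℕ) : ZMod N) = (A z.val : ZMod N)
        rw [hval _ hlt, hAeq z.val (z.val + 1) (by omega) fun d hd => ?_]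
        have : d ≠ z.val + 1 := by rintro rfl; exact hmem hd
        omega
  · have hc1 : c.val ∈ S := hc
    have hc1' : c'.val ∈ S := hc'
    have hcl := ZMod.val_lt c
    have hcl' := ZMod.val_lt c'
    have hac' : ((A c'.val : ℕ) : ZMod N) = ((A c.val + 1 : ℕ) : ZMod N) := by
      push_cast; exact hac
    have b1 := hA1 c.val
    have b2 := hAN c.val hcl
    have b3 := hA1 c'.val
    have b4 := hAN c'.val hcl'
    rcases b2.lt_or_eq with hlt | heq
    · have h1 := hcongr _ _ b3 b4 (by omega) (by omega) hac'
      have hcc : c.val < c'.val := by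
        by_contra! hge
        have := hAmono _ _ hge
        omega
      have := (hS _ hc1 _ hc1' hcc fun i hi => ?_).1
      · simpa using this
      · by_contra! hbt
        have h2 := hAlt _ i hi hbt.1
        have h3 := hAlt i _ hc1' hbt.2
        omega
    -- Here `c` is the last cut before `m`, so the next one is `0`, represented by `m`.
    · have h1 : A c'.val = 1 := by
        refine hcongr _ _ b3 b4 le_rfl (by omega) ?_
        rw [hac', heq]
        simp
      have h2 : c'.val = 0 := hAinj _ hc1' 0 h0S (by omega)
      have := (hS _ hc1 m hmS hcl fun i hi => ?_).1
      · rw [ZMod.val_eq_zero] at h2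
        simpa [h2] using this
      · by_contra! hbt
        have h2 := hAlt _ i hi hbt.1
        have h3 := hAlt i _ hmS hbt.2
        omega
  · exact ZMod.val_injective m (hAinj _ hc _ hc' (hcongr _ _ (hA1 _) (hAN _ (ZMod.val_lt c))
      (hA1 _) (hAN _ (ZMod.val_lt c')) hac))
  · have hzS : z.val ∉ S := hz
    have hzlt := ZMod.val_lt z
    obtain ⟨c, hc, hcmax⟩ := Finset.exists_max_image (S.filter (· ≤ z.val)) id
      ⟨0, Finset.mem_filter.2 ⟨h0S, Nat.zero_le _⟩⟩
    obtain ⟨c', hc', hcmin⟩ := Finset.exists_min_image (S.filter (z.val < ·)) id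
      ⟨m, Finset.mem_filter.2 ⟨hmS, hzlt⟩⟩
    simp only [Finset.mem_filter, id, and_imp] at hc hc' hcmax hcmin
    have hcz : c < z.val := lt_of_le_of_ne hc.2 fun h => hzS (h ▸ hc.1)
    have hconz : ∀ d ∈ S, d ≤ c ∨ c' ≤ d := fun d hd => by
      rcases le_or_gt d z.val with h | h
      · exact Or.inl (hcmax d hd h)
      · exact Or.inr (hcmin d hd h)
    obtain ⟨hnot, hbt⟩ := hS c hc.1 c' hc'.1 (by omega) hconz
    refine ⟨c, (hcast c hc.1).1, c', (hcast c' hc'.1).1, ?_, ?_, by simpa using hbt z.val hcz hc'.2,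
      ?_⟩
    · rw [(hcast c hc.1).2, hAeq c z.val hc.2 fun d hd => ?_]
      have := hconz d hd
      omega
    · rw [(hcast c' hc'.1).2, hAsucc z.val c' hc'.1 hc'.2 fun d hd => ?_]
      · push_cast; rfl
      · have := hconz d hd
        omega
    -- Let `q` be the first index after `c` not related to `c`, and `p` its predecessor. Then `p` is
    -- related to `c`, and `q`, if not `c'` itself, to `c'` by maximality.
    · have hex : ∃ q, c < q ∧ ¬ R (c : ZMod m) (q : ZMod m) := ⟨c', by omega, hnot⟩
      obtain ⟨hq1, hq2⟩ := Nat.find_spec hex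
      have hqmin := fun p => Nat.find_min hex (m := p)
      have hqc' : Nat.find hex ≤ c' := Nat.find_min' hex ⟨by omega, hnot⟩
      generalize Nat.find hex = q at *
      obtain ⟨p, rfl⟩ : ∃ p, q = p + 1 := ⟨q - 1, by omega⟩
      refine ⟨(p : ZMod m), ((p + 1 : ℕ) : ZMod m), ?_, by simpa using hsucc (p : ZMod m), ?_⟩
      · rcases (by omega : c ≤ p).lt_or_eq with h | rfl
        · by_contra hcon
          exact hqmin p (by omega) ⟨h, hcon⟩
        · exact hrefl _
      · rcases hqc'.lt_or_eq with h | rfl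
        · exact (hbt _ hq1 h).resolve_left hq2
        · exact hrefl _

/-! ### Circle-likeness of monotone images -/

/-- A compact space which carries a function without zeros and without a logarithm is circle-like,
if it has arbitrarily fine cyclic open covers (with possibly empty intersections). -/
theorem isCircleLike_of_cyclic_covers {Y : Type*} [MetricSpace Y] [CompactSpace Y] {h : Y → ℂ}
    (hh : Continuous h) (h0 : ∀ y, h y ≠ 0) (hlog : ¬ HasLogOn h univ)
    (hcov : ∀ ε > 0, ¬ (∀ x y : Y, dist x y < ε) → ∃ (N : ℕ) (_ : NeZero N) (V : ZMod N → Set Y),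
      (∀ k, IsOpen (V k)) ∧ (⋃ k, V k) = univ ∧
      (∀ k l, (V k ∩ V l).Nonempty → k - l = 0 ∨ k - l = 1 ∨ k - l = -1) ∧
      ∀ k, ∀ x ∈ V k, ∀ y ∈ V k, dist x y < ε) : IsCircleLike Y := by
  intro ε hε
  obtain ⟨δ, hδ, hsmall⟩ := exists_forall_dist_lt_ratio isCompact_univ hh.continuousOn
    fun y _ => h0 y
  have hsl : ∀ s : Set Y, (∀ x ∈ s, ∀ y ∈ s, dist x y < min (ε / 2) δ) → HasSmallLogOn h s :=
    fun s hs => hasSmallLogOn_of_ratio hh.continuousOn (fun y _ => h0 y) fun x hx y hy =>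
      hsmall x (mem_univ _) y (mem_univ _) ((hs x hx y hy).trans_le (min_le_right _ _))
  -- The bound `δ` yields small logarithms on the members, and `ε / 2` makes the diameter strictly
  -- less than `ε`.
  obtain ⟨N, hN, V, hV, hVc, hadj, hdist⟩ := hcov (min (ε / 2) δ) (by positivity)
    fun hall => hlog (hsl univ fun x _ y _ => hall x y).hasLogOn
  have hmeet : ∀ k, (V k ∩ V (k + 1)).Nonempty := fun k => by
    by_contra hemp
    exact hlog (hVc ▸ hasLogOn_of_broken_cyclic_chain V hV hadj k
      (not_nonempty_iff_eq_empty.1 hemp) fun l => hsl _ (hdist l))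
  refine ⟨N, V, ⟨?_, hV, fun k l => ⟨hadj k l, ?_⟩⟩, hVc, fun k => ?_⟩
  -- At most two members always form a linear chain.
  · by_contra! hlt
    have := hasLogOn_of_linear_chain (f := h) N (fun i => V (i : ZMod N)) (fun i _ => hV _)
      (fun i hi j hj _ => by omega) fun i _ => hsl _ (hdist _)
    refine hlog (this.mono fun y _ => ?_)
    obtain ⟨k, hk⟩ := mem_iUnion.1 (hVc ▸ mem_univ y)
    exact mem_iUnion₂.2 ⟨k.val, ZMod.val_lt k, by simpa using hk⟩
  · rintro (hkl | hkl | hkl)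
    · rw [sub_eq_zero.1 hkl, inter_self]
      exact (hmeet l).left
    · rw [sub_eq_iff_eq_add.1 hkl, inter_comm, add_comm]
      exact hmeet l
    · rw [show l = k + 1 by linear_combination -hkl]
      exact hmeet k
  · refine (Metric.diam_le_of_forall_dist_le (by positivity : 0 ≤ ε / 2) fun x hx y hy =>
      ((hdist k x hx y hy).trans_le (min_le_left _ _)).le).trans_lt (by linarith)

theorem IsMonotoneMap.exists_cyclic_cover {X Y : Type*} [MetricSpace X] [CompactSpace X]
    [MetricSpace Y] {f : X → Y} (hm : IsMonotoneMap f) (hc : Continuous f)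
    (hsurj : Function.Surjective f) (hX : IsCircleLike X) {ε : ℝ} (hε : 0 < ε)
    (hY : ¬ ∀ x y : Y, dist x y < ε) : ∃ (N : ℕ) (_ : NeZero N) (V : ZMod N → Set Y),
      (∀ k, IsOpen (V k)) ∧ (⋃ k, V k) = univ ∧
      (∀ k l, (V k ∩ V l).Nonempty → k - l = 0 ∨ k - l = 1 ∨ k - l = -1) ∧
      ∀ k, ∀ x ∈ V k, ∀ y ∈ V k, dist x y < ε := by
  -- Each point over `B k` will be within `5 * η` of the image of one cut link, so two such points
  -- are within `10 * η < ε`.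
  set η := ε / 12 with hη
  have hη0 : 0 < η := by positivity
  obtain ⟨δ, hδ, huc⟩ := Metric.uniformContinuous_iff.1
    (CompactSpace.uniformContinuous_of_continuous hc) η hη0
  obtain ⟨m, D, hD, hcov, hdiam⟩ := hX δ hδ
  have hm3 := hD.three_le
  have : NeZero m := ⟨by omega⟩
  have hDf : ∀ l, ∀ x ∈ D l, ∀ x' ∈ D l, dist (f x) (f x') ≤ η := fun l x hx x' hx' =>
    (huc ((Metric.dist_le_diam_of_mem (isCompact_univ.isBounded.subset (subset_univ _)) hx
      hx').trans_lt (hdiam l))).le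
  have hadj : ∀ i i', (D i ∩ D i').Nonempty → i' = i ∨ i' = i + 1 ∨ i = i' + 1 := fun i i' h => by
    rcases (hD.inter_nonempty_iff i i').1 h with h | h | h
    · exact Or.inl (sub_eq_zero.1 h).symm
    · exact Or.inr (Or.inr (by linear_combination h))
    · exact Or.inr (Or.inl (by linear_combination -h))
  let R : ZMod m → ZMod m → Prop := fun i i' => ∃ x ∈ D i, ∃ x' ∈ D i', f x = f x'
  have hDne : ∀ i, (D i).Nonempty := fun i => by
    have := (hD.inter_nonempty_iff i i).2 (Or.inl (sub_self i))
    rwa [inter_self] at this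
  have hRrefl : ∀ i, R i i := fun i => by
    obtain ⟨x, hx⟩ := hDne i
    exact ⟨x, hx, x, hx, rfl⟩
  have hRsymm : ∀ i i', R i i' → R i' i := fun i i' ⟨x, hx, x', hx', h⟩ =>
    ⟨x', hx', x, hx, h.symm⟩
  have hRsucc : ∀ i, R i (i + 1) := fun i => by
    obtain ⟨x, hx, hx'⟩ := (hD.inter_nonempty_iff i (i + 1)).2 (Or.inr (Or.inr (by ring)))
    exact ⟨x, hx, x, hx', rfl⟩
  -- distances grow by at most `η` for every link passed
  have hstep : ∀ {i i' : ZMod m} {y : Y} {r : ℝ}, R i i' → (∀ x ∈ D i, dist y (f x) ≤ r) →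
      ∀ x ∈ D i', dist y (f x) ≤ r + η := by
    rintro i i' y r ⟨x, hx, x', hx', hxx⟩ h z hz
    have h1 := h x hx
    have h2 := hDf i' x' hx' z hz
    have h3 := dist_triangle y (f x) (f z)
    rw [hxx] at h1 h3
    linarith
  obtain ⟨j, hj⟩ : ∃ j, ¬ R 0 j := by
    by_contra! hall
    refine hY fun y y' => ?_
    obtain ⟨x, rfl⟩ := hsurj y
    obtain ⟨x', rfl⟩ := hsurj y'
    obtain ⟨i, hi⟩ := mem_iUnion.1 (hcov ▸ mem_univ x)
    obtain ⟨i', hi'⟩ := mem_iUnion.1 (hcov ▸ mem_univ x')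
    have := hstep (hall i') (hstep (hRsymm _ _ (hall i)) (hDf i x hi)) x' hi'
    linarith
  obtain ⟨N, hN, a, S, h1, h2, h3, h4⟩ := exists_cyclic_blocks R hRrefl hRsymm hRsucc hj
  -- `B k` runs from just after the cut numbered `k - 1` to just before the cut numbered `k + 1`.
  let B : ZMod N → Set (ZMod m) := fun k => {i | a i = k ∨ (a i + 1 = k ∧ i ∉ S)}
  have hopen : ∀ I : Set (ZMod m), IsOpen (⋃ i ∈ I, D i) := fun I =>
    isOpen_biUnion fun i _ => hD.isOpen_link i
  -- a fibre that meets only links from `I ∪ I'` and a link from `I` lies over `I`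
  have hfib : ∀ (y : Y) (I I' : Set (ZMod m)),
      (∀ i, (f ⁻¹' {y} ∩ D i).Nonempty → i ∈ I ∨ i ∈ I') →
      (∀ i ∈ I, ∀ i' ∈ I', ¬ (D i ∩ D i').Nonempty) →
      (f ⁻¹' {y} ∩ ⋃ i ∈ I, D i).Nonempty → f ⁻¹' {y} ⊆ ⋃ i ∈ I, D i := by
    intro y I I' hI hdis hne
    refine (hm y).subset_left_of_subset_union (hopen I) (hopen I') ?_ (fun x hx => ?_) hne
    · rw [Set.disjoint_left]
      intro x hx hx'
      obtain ⟨i, hi, hxi⟩ := mem_iUnion₂.1 hx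
      obtain ⟨i', hi', hxi'⟩ := mem_iUnion₂.1 hx'
      exact hdis i hi i' hi' ⟨x, hxi, hxi'⟩
    · obtain ⟨i, hi⟩ := mem_iUnion.1 (hcov ▸ mem_univ x)
      exact (hI i ⟨x, hx, hi⟩).imp (fun h => mem_iUnion₂.2 ⟨i, h, hi⟩)
        (fun h => mem_iUnion₂.2 ⟨i, h, hi⟩)
  refine ⟨N, hN, fun k => {y | f ⁻¹' {y} ⊆ ⋃ i ∈ B k, D i},
    fun k => hc.isClosedMap.isOpen_setOf_preimage_subset (hopen _), ?_, ?_, ?_⟩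
  · refine eq_univ_of_forall fun y => mem_iUnion.2 ?_
    by_cases hcut : ∃ c ∈ S, (f ⁻¹' {y} ∩ D c).Nonempty
    · obtain ⟨c, hcS, x, hxy, hxc⟩ := hcut
      -- A fibre meeting the cut link `D c` misses the two neighbouring cut links, which are not
      -- near it, so connectedness confines it between them.
      refine ⟨a c, hfib y (B (a c)) {i | i ∉ B (a c) ∧ ¬ (i ∈ S ∧ (a i = a c + 1 ∨ a c = a i + 1))}
        ?_ ?_ ⟨x, hxy, mem_iUnion₂.2 ⟨c, Or.inl rfl, hxc⟩⟩⟩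
      · rintro i ⟨x', hx'y, hx'i⟩
        by_cases hi : i ∈ B (a c)
        · exact Or.inl hi
        · refine Or.inr ⟨hi, ?_⟩
          rintro ⟨hiS, hai | hai⟩
          · exact h2 c hcS i hiS hai ⟨x, hxc, x', hx'i, hxy.trans hx'y.symm⟩
          · exact h2 i hiS c hcS hai ⟨x', hx'i, x, hxc, hx'y.trans hxy.symm⟩
      · rintro i hi i' ⟨hi', hnot⟩ hne
        rcases hadj i i' hne with rfl | rfl | rfl
        · exact hi' hi
        · rcases h1 i with ⟨hs, ha⟩ | ⟨hs, hs', ha⟩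
          · rcases hi with hi | ⟨hi, hiS⟩
            · exact hi' (Or.inl (ha.trans hi))
            · exact hi' (Or.inr ⟨by rw [ha, hi], hs⟩)
          · rcases hi with hi | ⟨hi, hiS⟩
            · exact hnot ⟨hs, Or.inl (by rw [ha, hi])⟩
            · exact hi' (Or.inl (ha.trans hi))
        · rcases h1 i' with ⟨hs, ha⟩ | ⟨hs, hs', ha⟩
          · rcases hi with hi | ⟨hi, hiS⟩
            · exact hi' (Or.inl (ha.symm.trans hi))
            · by_cases hiS' : i' ∈ S
              · exact hnot ⟨hiS', Or.inr (by rw [← hi, ha])⟩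
              · exact hi' (Or.inr ⟨by rw [← ha, hi], hiS'⟩)
          · rcases hi with hi | ⟨hi, hiS⟩
            · exact hi' (Or.inr ⟨ha.symm.trans hi, hs'⟩)
            · exact hiS hs
    · push Not at hcut
      obtain ⟨x, hxy⟩ := hsurj y
      obtain ⟨i₀, hi₀⟩ := mem_iUnion.1 (hcov ▸ mem_univ x)
      have hnS : ∀ i, (f ⁻¹' {y} ∩ D i).Nonempty → i ∉ S := fun i hi hiS =>
        hi.ne_empty (hcut i hiS)
      -- A fibre that meets no cut link cannot leave the interior of its block.
      refine ⟨a i₀, (hfib y {i | i ∉ S ∧ a i = a i₀} {i | i ∉ S ∧ a i ≠ a i₀} (fun i hi => ?_) ?_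
        ⟨x, hxy, mem_iUnion₂.2 ⟨i₀, ⟨hnS i₀ ⟨x, hxy, hi₀⟩, rfl⟩, hi₀⟩⟩).trans
        (biUnion_subset_biUnion_left fun i hi => Or.inl hi.2)⟩
      · by_cases ha : a i = a i₀
        · exact Or.inl ⟨hnS i hi, ha⟩
        · exact Or.inr ⟨hnS i hi, ha⟩
      · rintro i ⟨hi, hai⟩ i' ⟨hi', hai'⟩ hne
        rcases hadj i i' hne with rfl | rfl | rfl
        · exact hai' hai
        · rcases h1 i with ⟨hs, ha⟩ | ⟨hs, hs', ha⟩
          · exact hai' (ha.trans hai)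
          · exact hi' hs
        · rcases h1 i' with ⟨hs, ha⟩ | ⟨hs, hs', ha⟩
          · exact hai' (ha.symm.trans hai)
          · exact hi hs
  · rintro k l ⟨y, hyk, hyl⟩
    obtain ⟨x, hxy⟩ := hsurj y
    obtain ⟨i, hi, hxi⟩ := mem_iUnion₂.1 (hyk hxy)
    obtain ⟨i', hi', hxi'⟩ := mem_iUnion₂.1 (hyl hxy)
    have aux : ∀ (k l : ZMod N) (i : ZMod m), i ∈ B k → i + 1 ∈ B l →
        k - l = 0 ∨ k - l = 1 ∨ k - l = -1 := by
      intro k l i hi hi'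
      rcases h1 i with ⟨hs, ha⟩ | ⟨hs, hs', ha⟩
      · rcases hi with rfl | ⟨rfl, hiS⟩ <;> rcases hi' with rfl | ⟨rfl, hiS'⟩ <;> rw [ha]
        · exact Or.inl (sub_self _)
        · exact Or.inr (Or.inr (by ring))
        · exact Or.inr (Or.inl (by ring))
        · exact Or.inl (sub_self _)
      · rcases hi' with rfl | ⟨rfl, hiS'⟩
        · rw [ha]
          rcases hi with rfl | ⟨rfl, hiS⟩
          · exact Or.inr (Or.inr (by ring))
          · exact Or.inl (sub_self _)
        · exact absurd hs hiS'
    rcases hadj i i' ⟨x, hxi, hxi'⟩ with rfl | rfl | rfl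
    · rcases hi with rfl | ⟨rfl, hiS⟩ <;> rcases hi' with rfl | ⟨rfl, hiS'⟩
      · exact Or.inl (sub_self _)
      · exact Or.inr (Or.inr (by ring))
      · exact Or.inr (Or.inl (by ring))
      · exact Or.inl (sub_self _)
    · exact aux k l i hi hi'
    · rcases aux l k i' hi' hi with h | h | h
      · exact Or.inl (by linear_combination -h)
      · exact Or.inr (Or.inr (by linear_combination -h))
      · exact Or.inr (Or.inl (by linear_combination -h))
  -- One `η` for the link itself, one for reaching a cut at an end of the block, and three for
  -- passing through `p` and `q` to the other cut.
  · have hnear : ∀ k, ∀ i ∈ B k, ∃ c ∈ S, a c = k ∧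
        ∀ x ∈ D i, ∀ z ∈ D c, dist (f x) (f z) ≤ 5 * η := by
      intro k i hi
      by_cases hiS : i ∈ S
      · refine ⟨i, hiS, hi.resolve_right fun h => h.2 hiS, fun x hx z hz => ?_⟩
        linarith [hDf i x hx z hz]
      · obtain ⟨c, hcS, c', hcS', hac, hac', hR, p, q, hcp, hpq, hqc⟩ := h4 i hiS
        have hc_of : ∀ x ∈ D i, (∀ z ∈ D c, dist (f x) (f z) ≤ 5 * η) ∧
            ∀ z ∈ D c', dist (f x) (f z) ≤ 5 * η := by
          intro x hx
          have h0 := hDf i x hx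
          rcases hR with hR | hR
          · have e1 := hstep (hRsymm _ _ hR) h0
            have e2 := hstep hqc (hstep hpq (hstep hcp e1))
            exact ⟨fun z hz => by linarith [e1 z hz], fun z hz => by linarith [e2 z hz]⟩
          · have e1 := hstep hR h0
            have e2 := hstep (hRsymm _ _ hcp) (hstep (hRsymm _ _ hpq) (hstep (hRsymm _ _ hqc) e1))
            exact ⟨fun z hz => by linarith [e2 z hz], fun z hz => by linarith [e1 z hz]⟩
        rcases hi with hi | ⟨hi, -⟩
        · exact ⟨c, hcS, hac.trans hi, fun x hx => (hc_of x hx).1⟩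
        · exact ⟨c', hcS', hac'.trans hi, fun x hx => (hc_of x hx).2⟩
    intro k y hy y' hy'
    obtain ⟨x, rfl⟩ := hsurj y
    obtain ⟨x', rfl⟩ := hsurj y'
    obtain ⟨i, hi, hxi⟩ := mem_iUnion₂.1 (hy rfl)
    obtain ⟨i', hi', hxi'⟩ := mem_iUnion₂.1 (hy' rfl)
    obtain ⟨c, hcS, hac, hcd⟩ := hnear k i hi
    obtain ⟨c', hcS', hac', hcd'⟩ := hnear k i' hi'
    obtain rfl := h3 c hcS c' hcS' (hac.trans hac'.symm)
    obtain ⟨z, hz⟩ := hDne c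
    have e1 := hcd x hxi z hz
    have e2 := hcd' x' hxi' z hz
    have e3 := dist_triangle_right (f x) (f x') (f z)
    linarith

/-! ### Conclusion for pseudo-circles in the annulus -/

/-- A nondegenerate monotone image of a pseudo-circle is a pseudo-circle, if it embeds in the
plane. -/
theorem IsPseudoCircle.of_isMonotoneMap {X Y : Type*} [MetricSpace X] [MetricSpace Y]
    [Nontrivial Y] (hX : IsPseudoCircle X) {f : X → Y} (hm : IsMonotoneMap f) (hc : Continuous f)
    (hsurj : Function.Surjective f) {e : Y → ℂ} (he : Topology.IsEmbedding e) :
    IsPseudoCircle Y := by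
  have : CompactSpace X := ⟨hX.isContinuum.1⟩
  have : CompactSpace Y := hsurj.compactSpace hc
  obtain ⟨k, hk, hk0, hklog⟩ := hX.isPlaneSeparating.exists_not_hasLogOn
  obtain ⟨h, hh, h0, hlog⟩ := hm.exists_not_hasLogOn hc hsurj hX.isCircleLike hk hk0 hklog
  refine ⟨⟨isCompact_univ, ?_⟩, ?_, isPlaneSeparating_of_not_hasLogOn he hh h0 hlog,
    hm.isHereditarilyIndecomposable hc hsurj hX.isHereditarilyIndecomposable⟩
  · have := hX.isContinuum.2.image f hc.continuousOn
    rwa [image_univ, hsurj.range_eq] at this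
  · exact isCircleLike_of_cyclic_covers hh h0 hlog fun ε hε hY =>
      hm.exists_cyclic_cover hc hsurj hX.isCircleLike hε hY

theorem Annulus.exists_isEmbedding : ∃ e : Annulus → ℂ, Topology.IsEmbedding e := by
  let e : Annulus → ℂ := fun x => ((1 + x.2 : ℝ) : ℂ) * x.1
  have hc : Continuous e := by fun_prop
  refine ⟨e, (hc.isClosedEmbedding fun x y hxy => ?_).isEmbedding⟩
  have hx : (0 : ℝ) < 1 + x.2 := by linarith [x.2.2.1]
  have hy : (0 : ℝ) < 1 + y.2 := by linarith [y.2.2.1]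
  have h2 : (1 + x.2 : ℝ) = 1 + y.2 := by
    have := congrArg norm hxy
    simpa only [e, norm_mul, Complex.norm_real, Real.norm_of_nonneg hx.le,
      Real.norm_of_nonneg hy.le, Circle.norm_coe, mul_one] using this
  have h1 : (x.1 : ℂ) = y.1 := by
    have hxy' : ((1 + x.2 : ℝ) : ℂ) * x.1 = ((1 + y.2 : ℝ) : ℂ) * y.1 := hxy
    rw [← h2] at hxy'
    exact mul_left_cancel₀ (Complex.ofReal_ne_zero.2 hx.ne') hxy'
  exact Prod.ext (Circle.ext h1) (Subtype.ext (by linarith))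

theorem proposition4p1 (φ : Annulus → Annulus) (hcont : Continuous φ)
    (hsurj : Function.Surjective φ) (hmono : IsMonotoneMap φ)
    (P Y : Set Annulus) (hP : IsPseudoCircle P)
    (hY : IsContinuum Y) (hYnt : Y.Nontrivial) (hPY : φ ⁻¹' Y = P) :
    IsPseudoCircle Y := by
  subst hPY
  have : Nontrivial Y := hYnt.coe_sort
  obtain ⟨e, he⟩ := Annulus.exists_isEmbedding
  refine hP.of_isMonotoneMap (f := Y.restrictPreimage φ) (fun y => ?_) hcont.restrictPreimage
    (hsurj.restrictPreimage Y) (he.comp Topology.IsEmbedding.subtypeVal)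
  -- Since `P` is a full preimage, the fibres of the restricted map are fibres of `φ`, and so are
  -- connected.
  have himg : (Subtype.val '' (Y.restrictPreimage φ ⁻¹' {y})) = φ ⁻¹' {(y : Annulus)} := by
    ext x
    constructor
    · rintro ⟨x, rfl, rfl⟩
      rfl
    · intro hx
      have hx' : φ x = y := hx
      exact ⟨⟨x, by rw [mem_preimage, hx']; exact y.2⟩, Subtype.ext hx', rfl⟩
  rw [← Topology.IsInducing.subtypeVal.isPreconnected_image, himg]
  exact hmono y
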